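/- Let $W$ denote the principal branch of the Lambert function, that is, the inverse of $w\mapsto we^w$ restricted to the region consisting of the real half-line $[-1,\infty)$, the points $u+iv$ with $0<v<\pi$, $u\ge -v\cot v$, and the points $u+iv$ with $-\pi<v<0$, $u>-v\cot v$. (Thus $W$ is defined on $\mathbb C$, with branch cut $(-\infty,-1/e]$, on which its values are the limits from above.) For $0<v<\pi$ put $$t(v)=-v\csc(v)\,e^{-v\cot v},\qquad K(z,v)=\frac{\bigl(1+z\,t(v)\bigr)\bigl(v^2+(1-v\cot v)^2\bigr)}{\bigl(z-t(v)\bigr)\bigl(1+t(v)^2\bigr)} .$$ Then the following hold. (1) For every complex $z\neq0$ with $|\arg z|<\pi$, all the integrals below converge absolutely and $$W(z)=\operatorname{Re}W(i)+\frac1\pi\int_0^\pi K(z,v)\,t(v)\,dv,$$ $$\frac{W(z)}z=e^{-\operatorname{Re}W(i)}\exp\Bigl(-\frac1\pi\int_0^\pi K(z,v)\,t(v)\,dv\Bigr),$$ $$\frac{W(z)}z=\operatorname{Re}\frac{W(i)}i+\frac1\pi\int_0^\pi K(z,v)\,dv,$$ $$\frac z{W(z)}=\operatorname{Re}\frac i{W(i)}-\frac1\pi\int_0^\pi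 K(z,v)\,e^{-2v\cot v}\,dv .$$ (2) $W$ is a Pick (Nevanlinna) function: it is holomorphic with $\operatorname{Im}W\ge0$ in the upper half-plane. Its Nevanlinna representation $f(z)=\alpha_0+b_0z+\int_{\mathbb R}\frac{1+tz}{(t-z)(1+t^2)}\,d\sigma(t)$, $\operatorname{Im}z>0$ (with $\alpha_0\in\mathbb R$, $b_0\ge0$ and $\sigma$ a positive measure with $\int(1+t^2)^{-1}d\sigma(t)<\infty$) has $\alpha_0=\operatorname{Re}W(i)$, $b_0=0$ and $d\sigma(t)=\frac1\pi\operatorname{Im}W(t)\,dt$. (3) $\operatorname{Re}\frac{W(i)}i=\operatorname{Im}W(i)$, and the constants have the (truncated) decimal values $\operatorname{Re}W(i)=0.3746990\ldots$, $e^{-\operatorname{Re}W(i)}=0.6874961\ldots$, $\operatorname{Im}W(i)=0.5764127\ldots$, $\operatorname{Re}\frac i{W(i)}=1.21953\ldots$ -/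

import Mathlib

open Complex MeasureTheory

noncomputable section

/-- The range of the principal branch of the Lambert function: the region lying between the curves
`u = -v cot v` with `0 < v < π` (included) and `-π < v < 0` (excluded), where `w = u + i v`,
together with the real half-line `u ≥ -1`. -/
def lambertRange : Set ℂ :=
  {w | w.im = 0 ∧ -1 ≤ w.re} ∪
  {w | 0 < w.im ∧ w.im < Real.pi ∧ -w.im * Real.cot w.im ≤ w.re} ∪
  {w | -Real.pi < w.im ∧ w.im < 0 ∧ -w.im * Real.cot w.im < w.re}

/-- The principal branch `W = W₀` of the Lambert function: the inverse of `w ↦ w e ^ w` restricted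
to the range of the principal branch. Its branch cut is `(-∞, -1/e]`, on which it is continuous
from above. -/
def lambertW : ℂ → ℂ :=
  Function.invFunOn (fun w : ℂ => w * exp w) lambertRange

/-- `t(v) = -v csc(v) e ^ (-v cot v)`. -/
def lambertT (v : ℝ) : ℝ :=
  -v * (Real.sin v)⁻¹ * Real.exp (-v * Real.cot v)

/-- `K(z, v) = (1 + z t(v)) (v² + (1 - v cot v)²) / ((z - t(v)) (1 + t(v)²))`. -/
def lambertK (z : ℂ) (v : ℝ) : ℂ :=
  ((1 + z * (lambertT v : ℂ)) * ((v ^ 2 + (1 - v * Real.cot v) ^ 2 : ℝ) : ℂ)) /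
    ((z - (lambertT v : ℂ)) * ((1 + lambertT v ^ 2 : ℝ) : ℂ))

/-- A Pick (Nevanlinna) function: holomorphic with non-negative imaginary part in the open upper
half-plane. -/
def IsPickFunction (f : ℂ → ℂ) : Prop :=
  DifferentiableOn ℂ f {z : ℂ | 0 < z.im} ∧ ∀ z : ℂ, 0 < z.im → 0 ≤ (f z).im

/-- The Nevanlinna representation
`f(z) = a + b z + ∫ (1 + t z) / ((t - z) (1 + t²)) dσ(t)` for `Im z > 0`, where `a` and `b ≥ 0` are
real and `σ` is a positive measure on `ℝ` with `∫ (1 + t²)⁻¹ dσ(t) < ∞`. -/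
def HasPickRepresentation (f : ℂ → ℂ) (a b : ℝ) (σ : Measure ℝ) : Prop :=
  0 ≤ b ∧ Integrable (fun t : ℝ => (1 + t ^ 2)⁻¹) σ ∧
    ∀ z : ℂ, 0 < z.im →
      f z = a + b * z + ∫ t : ℝ, (1 + (t : ℂ) * z) / (((t : ℂ) - z) * (1 + (t : ℂ) ^ 2)) ∂σ

/-- The measure `dσ(t) = (1/π) Im W(t) dt` on `ℝ`. -/
def lambertPickMeasure : Measure ℝ :=
  volume.withDensity fun t : ℝ => ENNReal.ofReal ((lambertW (t : ℂ)).im / Real.pi)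

end

/-! All integral formulas are instances of one: if `f` is continuous on the closed upper half-plane,
holomorphic inside, `o(z)` at infinity, and has `Im f(t) / (1 + t²)` integrable, then `f(z) = Re
f(i) + (1/π) ∫ Im f(t) k(z, t) dt` with `k(z, t) = (1 + t z) / ((t - z)(1 + t²))`. This follows from
Cauchy's theorem on large rectangles (`eq_add_integral_pickKernel`). If `f` is real on `[0, ∞)` and
commutes with conjugation, reflection and a limit at positive reals extend it to the cut plane.

It is applied to `f = g ∘ W` with `g(w) = w`, `-e^(-w)`, `e^w`; the last two give `W/z = e^(-W)` and
`z/W = e^W`. The analytic input is that `w ↦ w e^w` maps the closed upper half of the range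
bijectively onto the closed upper half-plane: injectivity comes from `w + log w`, surjectivity from
an open-and-closed argument (`injOn_lambertUpper`, `upperHalf_subset_image`). Properness then makes
`W` continuous up to the real line, and `|z| = |W| e^(Re W)` controls growth.

On the real line `Im W` is nonzero only at points `t(v)`, where `W(t(v)) = -v cot v + i v`.
Substituting `t = t(v)`, with `t' = t (v² + (1 - v cot v)²) / v`, produces `K` and the three weights
(`comp_lambertW_eq`). The constants come from `W(i) = a + i b` with `a = b tan b` and `e^a b / cos b
= 1`, a monotone condition on `b`. -/

section

open Filter Topology Set Asymptotics ComplexConjugate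

/-! ### Cauchy's theorem and Poisson's formula in the upper half-plane -/

/-- The filter of neighbourhoods of infinity in the closed upper half-plane. -/
noncomputable def upperInfty : Filter ℂ := Bornology.cobounded ℂ ⊓ 𝓟 {z : ℂ | 0 ≤ z.im}

/-- If `G` is continuous on the closed upper half-plane, holomorphic inside up to a countable set,
and `G(ζ) = o(1/ζ)` at infinity, then the symmetric integrals of `G` over the real line tend to
zero. -/
theorem tendsto_integral_symm_zero {G : ℂ → ℂ} {s : Set ℂ} (hs : s.Countable)
    (hc : ContinuousOn G {z : ℂ | 0 ≤ z.im})
    (hd : ∀ z : ℂ, 0 < z.im → z ∉ s → DifferentiableAt ℂ G z)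
    (ho : G =o[upperInfty] fun z => z⁻¹) :
    Tendsto (fun R : ℝ => ∫ x in (-R)..R, G x) atTop (𝓝 0) := by
  rw [Metric.tendsto_atTop]
  intro ε hε
  -- On the rectangle over `[-R, R]` of height `R`, the top side then costs at most `ε / 4` and each
  -- vertical side `ε / 8`.
  have h1 := ho.def (show (0 : ℝ) < ε / 8 by positivity)
  rw [upperInfty, eventually_inf_principal, ← comap_norm_atTop, eventually_comap] at h1
  obtain ⟨R0, hR0⟩ := eventually_atTop.1 h1
  refine ⟨max R0 1, fun R hR => ?_⟩
  have hRR : R0 ≤ R := (le_max_left _ _).trans hR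
  have hR1 : 1 ≤ R := (le_max_right _ _).trans hR
  have hRpos : 0 < R := by linarith
  have hbd : ∀ z : ℂ, 0 ≤ z.im → R ≤ ‖z‖ → ‖G z‖ ≤ ε / 8 * R⁻¹ := fun z hz hn => by
    refine (hR0 ‖z‖ (hRR.trans hn) z rfl hz).trans ?_
    rw [norm_inv]
    gcongr
  have key := Complex.integral_boundary_rect_eq_zero_of_differentiable_on_off_countable G
    (⟨-R, 0⟩ : ℂ) (⟨R, R⟩ : ℂ) s hs
    (hc.mono fun z hz => by
      have := hz.2
      simp only [mem_preimage, uIcc_of_le hRpos.le] at this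
      exact this.1)
    (fun z hz => hd z (by
      have := hz.1.2
      simp only [mem_preimage, min_eq_left hRpos.le] at this
      exact this.1) hz.2)
  simp only [ofReal_zero, zero_mul, add_zero] at key
  have h2 : ‖∫ x in (-R)..R, G (x + R * I)‖ ≤ ε / 8 * R⁻¹ * |R - -R| :=
    intervalIntegral.norm_integral_le_of_norm_le_const fun x _ => hbd _ (by simp [hRpos.le]) (by
      simpa [abs_of_pos hRpos] using abs_im_le_norm ((x : ℂ) + R * I))
  have h3 : ‖∫ y in (0 : ℝ)..R, G (R + y * I)‖ ≤ ε / 8 * R⁻¹ * |R - 0| :=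
    intervalIntegral.norm_integral_le_of_norm_le_const fun x hx => hbd _ (by
      rw [uIoc_of_le hRpos.le] at hx; simpa using hx.1.le) (by
      simpa [abs_of_pos hRpos] using abs_re_le_norm ((R : ℂ) + x * I))
  have h4 : ‖∫ y in (0 : ℝ)..R, G ((-R : ℝ) + y * I)‖ ≤ ε / 8 * R⁻¹ * |R - 0| :=
    intervalIntegral.norm_integral_le_of_norm_le_const fun x hx => hbd _ (by
      rw [uIoc_of_le hRpos.le] at hx; simpa using hx.1.le) (by
      simpa [abs_of_pos hRpos] using abs_re_le_norm (((-R : ℝ) : ℂ) + x * I))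
  have e1 : ε / 8 * R⁻¹ * |R - -R| = ε / 4 := by
    rw [abs_of_pos (by linarith)]; field_simp; norm_num
  have e2 : ε / 8 * R⁻¹ * |R - 0| = ε / 8 := by
    rw [sub_zero, abs_of_pos hRpos]; field_simp
  rw [e1] at h2
  rw [e2] at h3 h4
  have h5 : (∫ x in (-R)..R, G x) = (∫ x in (-R)..R, G (x + R * I)) -
      I * (∫ y in (0 : ℝ)..R, G (R + y * I)) +
      I * ∫ y in (0 : ℝ)..R, G ((-R : ℝ) + y * I) := by
    simp only [smul_eq_mul] at key
    linear_combination key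
  rw [dist_zero_right, h5]
  calc _ ≤ ε / 4 + ε / 8 + ε / 8 := by
        refine (norm_add_le _ _).trans (add_le_add ((norm_sub_le _ _).trans
          (add_le_add h2 ?_)) ?_) <;> rw [norm_mul, norm_I, one_mul] <;> assumption
    _ < ε := by linarith

theorem isBigO_inv_sub_upperInfty (a : ℂ) :
    (fun z : ℂ => (z - a)⁻¹) =O[upperInfty] fun z => z⁻¹ := by
  have h : (fun z : ℂ => z - a) ~[Bornology.cobounded ℂ] fun z => z := by
    rw [IsEquivalent]
    have : ((fun z : ℂ => z - a) - fun z => z) = fun _ => -a := by ext z; simp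
    rw [this]
    exact isLittleO_const_id_cobounded (-a)
  exact (h.inv.isBigO).mono inf_le_left

theorem sub_ne_zero_of_im {z a : ℂ} (h : z.im ≠ a.im) : z - a ≠ 0 := fun h' =>
  h (by rw [sub_eq_zero.1 h'])

theorem isLittleO_mul_inv_mul_inv {f : ℂ → ℂ} (ho : f =o[upperInfty] fun z => z) (a b : ℂ) :
    (fun z => f z * ((z - a)⁻¹ * (z - b)⁻¹)) =o[upperInfty] fun z => z⁻¹ := by
  refine (ho.mul_isBigO ((isBigO_inv_sub_upperInfty a).mul
    (isBigO_inv_sub_upperInfty b))).congr_right fun z => ?_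
  rcases eq_or_ne z 0 with rfl | h
  · simp
  · field_simp

theorem inv_sub_inv_sub {z a b : ℂ} (ha : z - a ≠ 0) (hb : z - b ≠ 0) :
    (z - a)⁻¹ - (z - b)⁻¹ = (a - b) * ((z - a)⁻¹ * (z - b)⁻¹) := by
  field_simp; ring

section
variable {f : ℂ → ℂ} (hc : ContinuousOn f {z : ℂ | 0 ≤ z.im})
  (hd : DifferentiableOn ℂ f {z : ℂ | 0 < z.im}) (ho : f =o[upperInfty] fun z => z)
include hc hd ho

/-- Lower half-plane poles contribute nothing to the symmetric integrals. -/
theorem tendsto_integral_mul_lower {a b : ℂ} (ha : a.im < 0) (hb : b.im < 0) :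
    Tendsto (fun R : ℝ => ∫ x in (-R)..R, f x * (((x : ℂ) - a)⁻¹ - ((x : ℂ) - b)⁻¹))
      atTop (𝓝 0) := by
  have hne : ∀ c : ℂ, c.im < 0 → ∀ z ∈ {z : ℂ | 0 ≤ z.im}, z - c ≠ 0 := fun c h z hz =>
    sub_ne_zero_of_im (by have : 0 ≤ z.im := hz; linarith)
  have hopen : IsOpen {z : ℂ | 0 < z.im} := isOpen_lt continuous_const continuous_im
  refine tendsto_integral_symm_zero (G := fun z => f z * ((z - a)⁻¹ - (z - b)⁻¹))
    countable_empty ?_ ?_ ?_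
  · refine hc.mul (ContinuousOn.sub ?_ ?_) <;>
    exact ContinuousOn.inv₀ (by fun_prop) (hne _ (by assumption))
  · intro z hz _
    have h1 := hne a ha z (show 0 < z.im from hz).le
    have h2 := hne b hb z (show 0 < z.im from hz).le
    exact (hd.differentiableAt (hopen.mem_nhds hz)).mul
      (((differentiableAt_id.sub_const a).inv h1).sub ((differentiableAt_id.sub_const b).inv h2))
  · refine ((isLittleO_mul_inv_mul_inv ho a b).const_mul_left (a - b)).congr' ?_ EventuallyEq.rfl
    have : ∀ᶠ z in upperInfty, z ∈ {z : ℂ | 0 ≤ z.im} := mem_inf_of_right (mem_principal_self _)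
    filter_upwards [this] with z hz
    rw [inv_sub_inv_sub (hne a ha z hz) (hne b hb z hz)]
    ring

end

/-- The right side is `2i` times a translated and rescaled `1 / (1 + x²)`, whose total mass `π` is
known. -/
theorem poisson_kernel_eq (a : ℂ) (ha : 0 < a.im) (x : ℝ) :
    ((x : ℂ) - a)⁻¹ - ((x : ℂ) - conj a)⁻¹ =
      2 * I * ((a.im⁻¹ * (1 + (a.im⁻¹ * (x - a.re)) ^ 2)⁻¹ : ℝ) : ℂ) := by
  have h1 : (x : ℂ) - a ≠ 0 := sub_ne_zero_of_im (by simp [ha.ne])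
  have h2 : (x : ℂ) - conj a ≠ 0 := sub_ne_zero_of_im (by simp [ha.ne'])
  rw [inv_sub_inv_sub h1 h2, ← mul_inv]
  have e1 : ((x : ℂ) - a) * ((x : ℂ) - conj a) = (((x - a.re) ^ 2 + a.im ^ 2 : ℝ) : ℂ) := by
    apply Complex.ext <;> simp [pow_two]; ring
  have e2 : a - conj a = 2 * I * (a.im : ℂ) := by
    rw [Complex.sub_conj]; push_cast; ring
  rw [e1, e2, mul_assoc]
  congr 1
  rw [← ofReal_inv, ← ofReal_mul]
  congr 1
  have : (0 : ℝ) < (x - a.re) ^ 2 + a.im ^ 2 := by positivity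
  field_simp
  ring

theorem tendsto_integral_poisson_kernel {a : ℂ} (ha : 0 < a.im) :
    Tendsto (fun R : ℝ => ∫ x in (-R)..R, (((x : ℂ) - a)⁻¹ - ((x : ℂ) - conj a)⁻¹))
      atTop (𝓝 (2 * Real.pi * I)) := by
  have hi : Integrable fun x : ℝ => (1 + (a.im⁻¹ * (x - a.re)) ^ 2)⁻¹ :=
    (integrable_inv_one_add_sq.comp_mul_left' (inv_ne_zero ha.ne')).comp_sub_right a.re
  have hi' := hi.const_mul a.im⁻¹
  have hval : ∫ x : ℝ, a.im⁻¹ * (1 + (a.im⁻¹ * (x - a.re)) ^ 2)⁻¹ = Real.pi := by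
    rw [integral_const_mul,
      integral_sub_right_eq_self (fun x : ℝ => (1 + (a.im⁻¹ * x) ^ 2)⁻¹) a.re,
      Measure.integral_comp_mul_left (fun x : ℝ => (1 + x ^ 2)⁻¹), integral_univ_inv_one_add_sq,
      inv_inv, abs_of_pos ha, smul_eq_mul]
    field_simp
  have h := intervalIntegral_tendsto_integral hi' tendsto_neg_atTop_atBot tendsto_id
  rw [hval] at h
  have h' := ((continuous_ofReal.tendsto _).comp h).const_mul (2 * I)
  have e : (2 * Real.pi * I : ℂ) = 2 * I * Real.pi := by ring
  rw [e]
  refine h'.congr fun R => ?_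
  simp only [poisson_kernel_eq a ha, intervalIntegral.integral_const_mul, Function.comp, id,
    intervalIntegral.integral_ofReal, ofReal_mul]

section
variable {f : ℂ → ℂ} (hc : ContinuousOn f {z : ℂ | 0 ≤ z.im})
  (hd : DifferentiableOn ℂ f {z : ℂ | 0 < z.im}) (ho : f =o[upperInfty] fun z => z)
include hc hd ho

/-- Poisson's formula for the upper half-plane. -/
theorem tendsto_integral_mul_poisson_kernel {a : ℂ} (ha : 0 < a.im) :
    Tendsto (fun R : ℝ => ∫ x in (-R)..R, f x * (((x : ℂ) - a)⁻¹ - ((x : ℂ) - conj a)⁻¹))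
      atTop (𝓝 (2 * Real.pi * I * f a)) := by
  have hne : ∀ z ∈ {z : ℂ | 0 ≤ z.im}, z - conj a ≠ 0 := fun z hz =>
    sub_ne_zero_of_im (by have : 0 ≤ z.im := hz; simp; linarith)
  have hopen : IsOpen {z : ℂ | 0 < z.im} := isOpen_lt continuous_const continuous_im
  have hda : DifferentiableAt ℂ f a := hd.differentiableAt (hopen.mem_nhds ha)
  have hcob : ∀ᶠ z in upperInfty, z ≠ a := by
    refine mem_inf_of_left ?_
    have : Bornology.IsBounded ({a} : Set ℂ) := Bornology.isBounded_singleton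
    exact this
  have hone : (fun _ : ℂ => (1 : ℂ)) =o[upperInfty] fun z => z :=
    (isLittleO_const_id_cobounded (1 : ℂ)).mono inf_le_left
  have hsub : (fun z => f z - f a) =o[upperInfty] fun z => z :=
    ho.sub ((hone.const_mul_left (f a)).congr_left fun z => by simp)
  -- Subtracting `f a` and passing to `dslope` removes the pole at `a`. Only continuity is needed at
  -- `a` itself, which is the exceptional point allowed in the contour lemma.
  have key := tendsto_integral_symm_zero
    (G := fun z => dslope f a z * ((a - conj a) * (z - conj a)⁻¹)) (countable_singleton a)
    (((continuousOn_dslope (mem_of_superset (hopen.mem_nhds ha)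
        fun z (hz : 0 < z.im) => hz.le)).2 ⟨hc, hda⟩).mul
      (continuousOn_const.mul (ContinuousOn.inv₀ (by fun_prop) hne)))
    (fun z hz hza => ((differentiableAt_dslope_of_ne hza).2
      (hd.differentiableAt (hopen.mem_nhds hz))).mul
      ((((differentiableAt_id (x := z)).sub_const (conj a)).inv (hne z hz.le)).const_mul _))
    (by
      refine ((isLittleO_mul_inv_mul_inv hsub a (conj a)).const_mul_left (a - conj a)).congr' ?_
        EventuallyEq.rfl
      filter_upwards [hcob] with z hz
      rw [dslope_of_ne _ hz, slope_def_field]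
      ring)
  have h2 := key.add ((tendsto_integral_poisson_kernel ha).const_mul (f a))
  rw [zero_add, mul_comm (f a)] at h2
  refine h2.congr fun R => ?_
  have hcr : Continuous fun x : ℝ => f x :=
    hc.comp_continuous continuous_ofReal fun x => by simp
  have hxa : ∀ x : ℝ, (x : ℂ) - a ≠ 0 := fun x => sub_ne_zero_of_im (by simp [ha.ne])
  have hxb : ∀ x : ℝ, (x : ℂ) - conj a ≠ 0 := fun x => sub_ne_zero_of_im (by simp [ha.ne'])
  have hP : Continuous fun x : ℝ => ((x : ℂ) - a)⁻¹ - ((x : ℂ) - conj a)⁻¹ :=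
    (Continuous.inv₀ (by fun_prop) hxa).sub (Continuous.inv₀ (by fun_prop) hxb)
  have e : ∀ x : ℝ, dslope f a x * ((a - conj a) * ((x : ℂ) - conj a)⁻¹) =
      f x * (((x : ℂ) - a)⁻¹ - ((x : ℂ) - conj a)⁻¹) -
        f a * (((x : ℂ) - a)⁻¹ - ((x : ℂ) - conj a)⁻¹) := fun x => by
    have hx : (x : ℂ) ≠ a := sub_ne_zero.1 (hxa x)
    rw [dslope_of_ne _ hx, slope_def_field, inv_sub_inv_sub (hxa x) (hxb x)]
    ring
  simp only [e]
  have hfP : Continuous fun x : ℝ => f x * (((x : ℂ) - a)⁻¹ - ((x : ℂ) - conj a)⁻¹) := hcr.mul hP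
  rw [intervalIntegral.integral_sub (hfP.intervalIntegrable _ _)
    ((hP.const_mul _).intervalIntegrable _ _), intervalIntegral.integral_const_mul]
  ring

end

/-! ### The Nevanlinna representation -/

/-- The normalized Cauchy kernel `(1 + t z) / ((t - z) (1 + t²))`. -/
noncomputable def pickKernel (z : ℂ) (t : ℝ) : ℂ :=
  (1 + (t : ℂ) * z) / (((t : ℂ) - z) * (1 + (t : ℂ) ^ 2))

theorem one_add_sq_ofReal_ne_zero (t : ℝ) : (1 + (t : ℂ) ^ 2) ≠ 0 := by
  have : (0 : ℝ) < 1 + t ^ 2 := by positivity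
  exact_mod_cast this.ne'

theorem conj_pickKernel (z : ℂ) (t : ℝ) : conj (pickKernel z t) = pickKernel (conj z) t := by
  simp [pickKernel]

/-- Partial fractions. The coefficients of the three poles sum to zero, so the kernel is a
combination of the differences of Cauchy kernels treated above. -/
theorem pickKernel_eq {z : ℂ} {t : ℝ} (h : (t : ℂ) - z ≠ 0) :
    pickKernel z t = ((t : ℂ) - z)⁻¹ - ((t : ℂ) - I)⁻¹ / 2 - ((t : ℂ) - conj I)⁻¹ / 2 := by
  have h1 : (t : ℂ) - I ≠ 0 := sub_ne_zero_of_im (by simp)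
  have h2 : (t : ℂ) + I ≠ 0 := by simpa using sub_ne_zero_of_im (z := t) (a := -I) (by simp)
  have e : (1 + (t : ℂ) ^ 2) = (t - I) * (t + I) := by
    linear_combination I_sq
  rw [pickKernel, e, conj_I, sub_neg_eq_add]
  field_simp
  linear_combination (2 : ℂ) * I_sq

theorem continuousAt_pickKernel {z : ℂ} {t : ℝ} (h : (t : ℂ) - z ≠ 0) :
    ContinuousAt (fun z => pickKernel z t) z :=
  ContinuousAt.div (by fun_prop) (by fun_prop) (mul_ne_zero h (one_add_sq_ofReal_ne_zero t))

theorem continuous_pickKernel {z : ℂ} (h : ∀ t : ℝ, (t : ℂ) - z ≠ 0) :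
    Continuous (pickKernel z) :=
  Continuous.div (by fun_prop) (by fun_prop)
    fun t => mul_ne_zero (h t) (one_add_sq_ofReal_ne_zero t)

theorem measurable_pickKernel (z : ℂ) : Measurable (pickKernel z) := by
  unfold pickKernel; fun_prop

theorem norm_pickKernel_le {z : ℂ} {t c : ℝ} (h : (t : ℂ) - z ≠ 0)
    (hc : ‖1 + (t : ℂ) * z‖ ≤ c * ‖(t : ℂ) - z‖) : ‖pickKernel z t‖ ≤ c * (1 + t ^ 2)⁻¹ := by
  have e : ‖(1 + (t : ℂ) ^ 2)‖ = 1 + t ^ 2 := by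
    have : (1 + (t : ℂ) ^ 2) = ((1 + t ^ 2 : ℝ) : ℂ) := by push_cast; ring
    rw [this, Complex.norm_real, Real.norm_of_nonneg (by positivity)]
  rw [pickKernel, norm_div, norm_mul, e, div_le_iff₀ (by positivity)]
  refine hc.trans (le_of_eq ?_)
  have : (0 : ℝ) < 1 + t ^ 2 := by positivity
  field_simp

/-- Off the cut, `|1 + t z| ≤ c |t - z|`. -/
theorem exists_norm_one_add_mul_le {z : ℂ} (h : ∀ t : ℝ, t ≤ 0 → (t : ℂ) - z ≠ 0)
    {S : Set ℝ} (hS : S = Iic 0 ∨ z.im ≠ 0) :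
    ∃ c : ℝ, 0 ≤ c ∧ ∀ t ∈ S, ‖1 + (t : ℂ) * z‖ ≤ c * ‖(t : ℂ) - z‖ := by
  obtain ⟨δ, hδ, hδt⟩ : ∃ δ : ℝ, 0 < δ ∧ ∀ t ∈ S, δ ≤ ‖(t : ℂ) - z‖ := by
    by_cases him : z.im = 0
    · obtain rfl : S = Iic 0 := hS.resolve_right (by simpa using him)
      have hz : 0 < z.re := by
        by_contra hz
        exact h z.re (not_lt.1 hz) (by apply Complex.ext <;> simp [him])
      refine ⟨z.re, hz, fun t ht => ?_⟩
      have h1 := abs_re_le_norm ((t : ℂ) - z)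
      have h2 := neg_le_abs ((t : ℂ) - z).re
      simp only [sub_re, ofReal_re, mem_Iic] at h1 h2 ht
      linarith
    · refine ⟨|z.im|, abs_pos.2 him, fun t _ => ?_⟩
      simpa using abs_im_le_norm ((t : ℂ) - z)
  refine ⟨‖z‖ + ‖1 + z * z‖ / δ, by positivity, fun t ht => ?_⟩
  have e : 1 + (t : ℂ) * z = z * (t - z) + (1 + z * z) := by ring
  rw [e, add_mul]
  refine (norm_add_le _ _).trans (add_le_add (norm_mul _ _).le ?_)
  rw [div_mul_eq_mul_div, le_div_iff₀ hδ]
  exact mul_le_mul_of_nonneg_left (hδt t ht) (norm_nonneg _)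

section
variable {f : ℂ → ℂ}

/-- The kernel is `O(1 / (1 + t²))` away from its pole. The pole is harmless either because `z` is
not real or because the density vanishes on the half-line where a real `z` off the cut lies. -/
theorem integrable_im_mul_pickKernel (hcr : Continuous fun x : ℝ => f x)
    (hint : Integrable fun t : ℝ => (f t).im * (1 + t ^ 2)⁻¹) {z : ℂ}
    (h : (∀ t : ℝ, 0 ≤ t → (f t).im = 0) ∨ z.im ≠ 0)
    (hz : ∀ t : ℝ, t ≤ 0 → (t : ℂ) - z ≠ 0) :
    Integrable fun t : ℝ => ((f t).im : ℂ) * pickKernel z t := by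
  obtain ⟨c, hc0, hc⟩ : ∃ c : ℝ, 0 ≤ c ∧ ∀ t : ℝ, (f t).im ≠ 0 →
      ‖1 + (t : ℂ) * z‖ ≤ c * ‖(t : ℂ) - z‖ := by
    rcases h with h | h
    · obtain ⟨c, h0, hc⟩ := exists_norm_one_add_mul_le hz (Or.inl rfl)
      exact ⟨c, h0, fun t ht => hc t (le_of_not_ge fun h' => ht (h t h'))⟩
    · obtain ⟨c, h0, hc⟩ := exists_norm_one_add_mul_le (S := univ) hz (Or.inr h)
      exact ⟨c, h0, fun t _ => hc t trivial⟩
  have hm : Measurable fun t : ℝ => ((f t).im : ℂ) * pickKernel z t :=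
    (continuous_ofReal.comp (continuous_im.comp hcr)).measurable.mul (measurable_pickKernel z)
  refine (hint.norm.const_mul c).mono' hm.aestronglyMeasurable (Eventually.of_forall fun t => ?_)
  by_cases h0 : (f t).im = 0
  · simp [h0]
  have hne : (t : ℂ) - z ≠ 0 := by
    rcases h with h | h
    · exact hz t (le_of_not_ge fun h' => h0 (h t h'))
    · exact sub_ne_zero_of_im (by simpa using h.symm)
  have h1 := norm_pickKernel_le hne (hc t h0)
  rw [norm_mul, norm_mul, Complex.norm_real,
    Real.norm_of_nonneg (show (0 : ℝ) ≤ (1 + t ^ 2)⁻¹ by positivity)]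
  calc _ ≤ ‖(f t).im‖ * (c * (1 + t ^ 2)⁻¹) := by gcongr
    _ = _ := by ring

/-- The Nevanlinna representation of a function that is holomorphic in the upper half-plane,
continuous up to the boundary, and `o(z)` at infinity. -/
theorem eq_add_integral_pickKernel (hc : ContinuousOn f {z : ℂ | 0 ≤ z.im})
    (hd : DifferentiableOn ℂ f {z : ℂ | 0 < z.im}) (ho : f =o[upperInfty] fun z => z)
    (hint : Integrable fun t : ℝ => (f t).im * (1 + t ^ 2)⁻¹) {z : ℂ} (hz : 0 < z.im) :
    f z = ((f I).re : ℂ) + 1 / (Real.pi : ℂ) * ∫ t : ℝ, ((f t).im : ℂ) * pickKernel z t := by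
  have hcr : Continuous fun x : ℝ => f x :=
    hc.comp_continuous continuous_ofReal fun x => by simp
  have hne : ∀ c : ℂ, c.im ≠ 0 → ∀ x : ℝ, (x : ℂ) - c ≠ 0 := fun c h x =>
    sub_ne_zero_of_im (by simpa using h.symm)
  have hI : (0 : ℝ) < I.im := by simp
  have hinv : ∀ c : ℂ, c.im ≠ 0 → Continuous fun x : ℝ => ((x : ℂ) - c)⁻¹ := fun c h =>
    Continuous.inv₀ (by fun_prop) (hne c h)
  have hz' : (conj z).im ≠ 0 := by simpa using hz.ne'
  have hPz := tendsto_integral_mul_poisson_kernel hc hd ho hz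
  have hPI := tendsto_integral_mul_poisson_kernel hc hd ho hI
  have hC := tendsto_integral_mul_lower hc hd ho (a := conj z) (b := conj I)
    (by simpa using hz) (by simp)
  have ii : ∀ a b : ℂ, a.im ≠ 0 → b.im ≠ 0 → ∀ R : ℝ,
      IntervalIntegrable (fun x : ℝ => f x * (((x : ℂ) - a)⁻¹ - ((x : ℂ) - b)⁻¹)) volume (-R) R :=
    fun a b ha hb R => (hcr.mul ((hinv a ha).sub (hinv b hb))).intervalIntegrable _ _
  have hconjI : (conj I).im ≠ 0 := by simp
  -- the integrals of `f` against the kernels of `z` and of `conj z`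
  have h1 : Tendsto (fun R : ℝ => ∫ x in (-R)..R, f x * pickKernel z x) atTop
      (𝓝 (2 * Real.pi * I * f z + 0 - 1 / 2 * (2 * Real.pi * I * f I))) := by
    refine ((hPz.add hC).sub (hPI.const_mul (1 / 2))).congr fun R => ?_
    rw [← intervalIntegral.integral_add (ii _ _ hz.ne' hz' R) (ii _ _ hz' hconjI R),
      ← intervalIntegral.integral_const_mul, ← intervalIntegral.integral_sub
        ((ii _ _ hz.ne' hz' R).add (ii _ _ hz' hconjI R)) ((ii _ _ hI.ne' hconjI R).const_mul _)]
    refine intervalIntegral.integral_congr fun x _ => ?_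
    rw [pickKernel_eq (hne z hz.ne' x)]
    ring
  have h2 : Tendsto (fun R : ℝ => ∫ x in (-R)..R, f x * pickKernel (conj z) x) atTop
      (𝓝 (0 - 1 / 2 * (2 * Real.pi * I * f I))) := by
    refine (hC.sub (hPI.const_mul (1 / 2))).congr fun R => ?_
    rw [← intervalIntegral.integral_const_mul, ← intervalIntegral.integral_sub
        (ii _ _ hz' hconjI R) ((ii _ _ hI.ne' hconjI R).const_mul _)]
    refine intervalIntegral.integral_congr fun x _ => ?_
    rw [pickKernel_eq (hne _ hz' x)]
    ring
  -- Conjugation turns the kernel of `conj z` into that of `z` and `f` into its conjugate. The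
  -- difference with `h1` thus integrates `2i Im f` against the kernel of `z`, with limit `2πi (f z
  -- - Re f(i))`.
  have h3 := (continuous_conj.tendsto _).comp h2
  have h4 := h1.sub h3
  have hmain := integrable_im_mul_pickKernel hcr hint (z := z) (Or.inr hz.ne')
    fun t _ => hne z hz.ne' t
  have h5 := intervalIntegral_tendsto_integral (hmain.const_mul (2 * I)) tendsto_neg_atTop_atBot
    tendsto_id
  have h6 : (∫ t : ℝ, 2 * I * (((f t).im : ℂ) * pickKernel z t)) = _ :=
    tendsto_nhds_unique (h5.congr fun R => ?_) h4
  swap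
  · simp only [Function.comp, id]
    rw [← intervalIntegral.intervalIntegral_conj, ← intervalIntegral.integral_sub]
    · refine intervalIntegral.integral_congr fun x _ => ?_
      rw [map_mul, conj_pickKernel, conj_conj, ← sub_mul, Complex.sub_conj]
      push_cast
      ring
    · exact (hcr.mul (continuous_pickKernel (hne z hz.ne'))).intervalIntegrable _ _
    · exact (continuous_conj.comp
        (hcr.mul (continuous_pickKernel (hne _ hz')))).intervalIntegrable _ _
  rw [integral_const_mul] at h6
  have hpi : (Real.pi : ℂ) ≠ 0 := by exact_mod_cast Real.pi_ne_zero
  have h7 : ((f I).re : ℂ) = (f I + conj (f I)) / 2 := by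
    rw [Complex.add_conj]; push_cast; ring
  rw [h7]
  simp only [map_sub, map_mul, map_zero, map_ofNat, map_div₀, map_one, conj_I, conj_ofReal] at h6
  have h8 : (∫ t : ℝ, ((f t).im : ℂ) * pickKernel z t) =
      Real.pi * (f z - (f I + conj (f I)) / 2) := by
    apply mul_left_cancel₀ (show (2 * I : ℂ) ≠ 0 by simp)
    rw [h6]; ring
  rw [h8]
  field_simp
  ring

theorem continuousAt_integral_pickKernel (hcr : Continuous fun x : ℝ => f x)
    (hint : Integrable fun t : ℝ => (f t).im * (1 + t ^ 2)⁻¹)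
    (h0 : ∀ t : ℝ, 0 ≤ t → (f t).im = 0) {x : ℝ} (hx : 0 < x) :
    ContinuousAt (fun z : ℂ => ∫ t : ℝ, ((f t).im : ℂ) * pickKernel z t) x := by
  have hnear : ∀ᶠ z : ℂ in 𝓝 (x : ℂ), x / 2 < z.re ∧ ‖z‖ < x + 1 := by
    refine (continuous_re.tendsto (x : ℂ)).eventually_const_lt (by simp; linarith) |>.and ?_
    refine (continuous_norm.tendsto (x : ℂ)).eventually_lt_const ?_
    simp [abs_of_pos hx]
  refine continuousAt_of_dominated
    (bound := fun t => (2 / x + (x + 1)) * ‖(f t).im * (1 + t ^ 2)⁻¹‖) ?_ ?_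
    (hint.norm.const_mul _) ?_
  · exact Eventually.of_forall fun z => ((continuous_ofReal.comp
      (continuous_im.comp hcr)).measurable.mul (measurable_pickKernel z)).aestronglyMeasurable
  · filter_upwards [hnear] with z ⟨hz1, hz2⟩
    refine Eventually.of_forall fun t => ?_
    rcases le_or_gt 0 t with ht | ht
    · simp [h0 t ht]
    have hre : x / 2 + -t ≤ ‖(t : ℂ) - z‖ := by
      have h1 := abs_re_le_norm ((t : ℂ) - z)
      have h2 := neg_le_abs ((t : ℂ) - z).re
      simp only [sub_re, ofReal_re] at h1 h2
      linarith
    have hne : (t : ℂ) - z ≠ 0 := norm_pos_iff.1 (by linarith)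
    -- The distance to the pole is at least `x / 2 - t`; the coefficient `2 / x` absorbs the term
    -- `1`, and `x + 1` bounds `‖z‖`.
    have hb : ‖1 + (t : ℂ) * z‖ ≤ (2 / x + (x + 1)) * ‖(t : ℂ) - z‖ := by
      calc ‖1 + (t : ℂ) * z‖ ≤ 1 + -t * (x + 1) := by
            refine (norm_add_le _ _).trans ?_
            rw [norm_one, norm_mul, Complex.norm_real, Real.norm_of_nonpos ht.le]
            gcongr
            linarith
        _ ≤ (2 / x + (x + 1)) * (x / 2 + -t) := by
            have e : (2 / x + (x + 1)) * (x / 2 + -t) =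
              1 + -t * (x + 1) + (2 / x * -t + (x + 1) * (x / 2)) := by field_simp; ring
            rw [e]
            have : 0 ≤ 2 / x * -t := mul_nonneg (by positivity) (by linarith)
            have : 0 ≤ (x + 1) * (x / 2) := by positivity
            linarith
        _ ≤ _ := by gcongr
    have h1 := norm_pickKernel_le hne hb
    rw [norm_mul, norm_mul, Complex.norm_real,
      Real.norm_of_nonneg (show (0 : ℝ) ≤ (1 + t ^ 2)⁻¹ by positivity)]
    calc _ ≤ ‖(f t).im‖ * ((2 / x + (x + 1)) * (1 + t ^ 2)⁻¹) := by gcongr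
      _ = _ := by ring
  · refine Eventually.of_forall fun t => ?_
    rcases le_or_gt 0 t with ht | ht
    · simp only [h0 t ht, ofReal_zero, zero_mul]; exact continuousAt_const
    · exact continuousAt_const.mul (continuousAt_pickKernel (by
        rw [← ofReal_sub]; exact_mod_cast (show t - x ≠ 0 by linarith)))

/-- The Nevanlinna representation on the cut plane. -/
theorem eq_add_integral_pickKernel_of_mem_slitPlane (hc : ContinuousOn f {z : ℂ | 0 ≤ z.im})
    (hd : DifferentiableOn ℂ f {z : ℂ | 0 < z.im}) (ho : f =o[upperInfty] fun z => z)
    (hint : Integrable fun t : ℝ => (f t).im * (1 + t ^ 2)⁻¹)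
    (h0 : ∀ t : ℝ, 0 ≤ t → (f t).im = 0) (hconj : ∀ z : ℂ, 0 < z.im → f (conj z) = conj (f z))
    {z : ℂ} (hz : z ∈ slitPlane) :
    f z = ((f I).re : ℂ) + 1 / (Real.pi : ℂ) * ∫ t : ℝ, ((f t).im : ℂ) * pickKernel z t := by
  rcases lt_trichotomy z.im 0 with him | him | him
  · have him' : 0 < (conj z).im := by simpa using him
    have h1 := congrArg conj (eq_add_integral_pickKernel hc hd ho hint him')
    rw [← hconj _ him', conj_conj] at h1
    rw [h1]
    simp only [map_add, map_mul, map_div₀, map_one, conj_ofReal, ← integral_conj,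
      conj_pickKernel, conj_conj]
  · have hre : 0 < z.re := by
      rcases mem_slitPlane_iff.1 hz with h | h
      · exact h
      · exact absurd him h
    obtain ⟨x, rfl⟩ : ∃ x : ℝ, z = x := ⟨z.re, by apply Complex.ext <;> simp [him]⟩
    rw [ofReal_re] at hre
    -- At a positive real point both sides are limits from the open upper half-plane.
    have hcl : (x : ℂ) ∈ closure {z : ℂ | 0 < z.im} := by
      rw [closure_setOfPred_lt_im]; simp
    have : (𝓝[{z : ℂ | 0 < z.im}] (x : ℂ)).NeBot := mem_closure_iff_nhdsWithin_neBot.1 hcl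
    have l1 : Tendsto f (𝓝[{z : ℂ | 0 < z.im}] (x : ℂ)) (𝓝 (f x)) :=
      (hc x (by simp)).mono_left (nhdsWithin_mono _ fun z (h : 0 < z.im) => h.le)
    have l2 := (((continuousAt_integral_pickKernel (hc.comp_continuous continuous_ofReal
      fun x => by simp) hint h0 hre).tendsto.mono_left (nhdsWithin_le_nhds
        (s := {z : ℂ | 0 < z.im}))).const_mul (1 / (Real.pi : ℂ))).const_add ((f I).re : ℂ)
    refine tendsto_nhds_unique l1 (l2.congr' ?_)
    filter_upwards [self_mem_nhdsWithin] with z hz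
    exact (eq_add_integral_pickKernel hc hd ho hint hz).symm
  · exact eq_add_integral_pickKernel hc hd ho hint him

end

/-! ### The map `w ↦ w e^w` on the upper half of the range -/

theorem hasDerivAt_mul_exp (w : ℂ) : HasDerivAt (fun w : ℂ => w * exp w) ((1 + w) * exp w) w := by
  refine ((hasDerivAt_id w).mul (hasDerivAt_exp w)).congr_deriv ?_
  simp only [id]; ring

theorem continuous_mul_exp : Continuous fun w : ℂ => w * exp w := by fun_prop

theorem mul_exp_im (w : ℂ) :
    (w * exp w).im = Real.exp w.re * (w.re * Real.sin w.im + w.im * Real.cos w.im) := by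
  rw [mul_im, exp_re, exp_im]; ring

theorem mul_exp_re (w : ℂ) :
    (w * exp w).re = Real.exp w.re * (w.re * Real.cos w.im - w.im * Real.sin w.im) := by
  rw [mul_re, exp_re, exp_im]; ring

theorem mul_cos_lt_sin {v : ℝ} (h0 : 0 < v) (hpi : v < Real.pi) :
    v * Real.cos v < Real.sin v := by
  rcases lt_or_ge v (Real.pi / 2) with h | h
  · have h1 := Real.lt_tan h0 h
    have h2 : 0 < Real.cos v := Real.cos_pos_of_mem_Ioo ⟨by linarith, h⟩
    rwa [Real.tan_eq_sin_div_cos, lt_div_iff₀ h2] at h1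
  · have h1 : Real.cos v ≤ 0 := Real.cos_nonpos_of_pi_div_two_le_of_le h (by linarith)
    have h2 := Real.sin_pos_of_pos_of_lt_pi h0 hpi
    nlinarith

theorem mul_cot_lt_one {v : ℝ} (h0 : 0 < v) (hpi : v < Real.pi) : v * Real.cot v < 1 := by
  have h2 := Real.sin_pos_of_pos_of_lt_pi h0 hpi
  rw [Real.cot_eq_cos_div_sin, ← mul_div_assoc, div_lt_one h2]
  exact mul_cos_lt_sin h0 hpi

/-- The closed upper half of the range of the principal branch. -/
def lambertUpper : Set ℂ :=
  {w | (0 ≤ w.im ∧ w.im ≤ Real.pi) ∧ -1 ≤ w.re ∧ 0 ≤ (w * exp w).im}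

theorem isClosed_lambertUpper : IsClosed lambertUpper :=
  ((isClosed_le continuous_const continuous_im).inter
    (isClosed_le continuous_im continuous_const)).inter
    ((isClosed_le continuous_const continuous_re).inter
      (isClosed_le continuous_const (continuous_im.comp continuous_mul_exp)))

theorem mul_exp_im_eq {w : ℂ} (h : Real.sin w.im ≠ 0) :
    (w * exp w).im = Real.exp w.re * Real.sin w.im * (w.re - -w.im * Real.cot w.im) := by
  rw [mul_exp_im, Real.cot_eq_cos_div_sin]
  field_simp
  ring

theorem mul_exp_im_nonneg_iff {w : ℂ} (h0 : 0 < w.im) (hpi : w.im < Real.pi) :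
    0 ≤ (w * exp w).im ↔ -w.im * Real.cot w.im ≤ w.re := by
  have hs := Real.sin_pos_of_pos_of_lt_pi h0 hpi
  rw [mul_exp_im_eq hs.ne', mul_nonneg_iff_of_pos_left (mul_pos (Real.exp_pos _) hs), sub_nonneg]

theorem mul_exp_im_pos_iff {w : ℂ} (h0 : 0 < w.im) (hpi : w.im < Real.pi) :
    0 < (w * exp w).im ↔ -w.im * Real.cot w.im < w.re := by
  have hs := Real.sin_pos_of_pos_of_lt_pi h0 hpi
  rw [mul_exp_im_eq hs.ne', mul_pos_iff_of_pos_left (mul_pos (Real.exp_pos _) hs), sub_pos]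

theorem lambertUpper_im_lt_pi {w : ℂ} (hw : w ∈ lambertUpper) : w.im < Real.pi := by
  refine lt_of_le_of_ne hw.1.2 fun h => ?_
  have h1 := hw.2.2
  rw [mul_exp_im, h] at h1
  have := mul_pos (Real.exp_pos w.re) Real.pi_pos
  simp at h1
  linarith

/-- Links the closed inequalities, suited to compactness, with the cotangent description. The line
`Im w = π` drops out because `Im (w e^w) = -π e^(Re w) < 0` there, and `Re w ≥ -1` is automatic
above the curve since `v cot v < 1`. -/
theorem mem_lambertUpper_iff (w : ℂ) : w ∈ lambertUpper ↔
    (w.im = 0 ∧ -1 ≤ w.re) ∨ (0 < w.im ∧ w.im < Real.pi ∧ -w.im * Real.cot w.im ≤ w.re) := by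
  constructor
  · intro hw
    rcases hw.1.1.eq_or_lt with h | h
    · exact Or.inl ⟨h.symm, hw.2.1⟩
    · have hpi := lambertUpper_im_lt_pi hw
      exact Or.inr ⟨h, hpi, (mul_exp_im_nonneg_iff h hpi).1 hw.2.2⟩
  · rintro (⟨h, h1⟩ | ⟨h, hpi, h1⟩)
    · exact ⟨⟨h.ge, h.trans_le Real.pi_pos.le⟩, h1, by rw [mul_exp_im, h]; simp⟩
    · refine ⟨⟨h.le, hpi.le⟩, ?_, (mul_exp_im_nonneg_iff h hpi).2 h1⟩
      have := mul_cot_lt_one h hpi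
      linarith

theorem lambertUpper_subset : lambertUpper ⊆ lambertRange := fun w hw =>
  Or.inl ((mem_lambertUpper_iff w).1 hw)

theorem conj_mul_exp (w : ℂ) : conj w * exp (conj w) = conj (w * exp w) := by
  rw [map_mul, exp_conj]

/-- Off the upper half, points of the range are conjugates of points with `Im (w e ^ w) > 0`. -/
theorem lambertRange_cases {w : ℂ} (hw : w ∈ lambertRange) :
    w ∈ lambertUpper ∨ (conj w ∈ lambertUpper ∧ (w * exp w).im < 0) := by
  rcases hw with hw | ⟨h1, h2, h3⟩
  · exact Or.inl ((mem_lambertUpper_iff w).2 hw)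
  · have hc : -(conj w).im * Real.cot (conj w).im < (conj w).re := by
      have : Real.cot (-w.im) = -Real.cot w.im := by
        rw [Real.cot_eq_cos_div_sin, Real.cot_eq_cos_div_sin, Real.cos_neg, Real.sin_neg, div_neg]
      rw [conj_im, conj_re, this]
      linarith
    have h0 : 0 < (conj w).im := by simpa using h2
    have hpi : (conj w).im < Real.pi := by rw [conj_im]; linarith
    refine Or.inr ⟨(mem_lambertUpper_iff _).2 (Or.inr ⟨h0, hpi, hc.le⟩), ?_⟩
    have := (mul_exp_im_pos_iff h0 hpi).2 hc
    rw [conj_mul_exp, conj_im] at this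
    linarith

theorem conj_mem_lambertRange {w : ℂ} (hw : w ∈ lambertUpper) (h : 0 < (w * exp w).im) :
    conj w ∈ lambertRange := by
  rcases (mem_lambertUpper_iff w).1 hw with ⟨h1, _⟩ | ⟨h1, h2, _⟩
  · rw [mul_exp_im, h1] at h; simp at h
  · have h3 := (mul_exp_im_pos_iff h1 h2).1 h
    have : Real.cot (-w.im) = -Real.cot w.im := by
      rw [Real.cot_eq_cos_div_sin, Real.cot_eq_cos_div_sin, Real.cos_neg, Real.sin_neg, div_neg]
    refine Or.inr ⟨by rw [conj_im]; linarith, by rw [conj_im]; linarith, ?_⟩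
    rw [conj_im, conj_re, this]
    linarith

/-- `w + log w` is injective on the upper half-plane. -/
theorem injOn_add_log : InjOn (fun w : ℂ => w + log w) {w : ℂ | 0 < w.im} := by
  intro a ha b hb hab
  by_contra hne
  have hd : b - a ≠ 0 := sub_ne_zero.2 (Ne.symm hne)
  have him : ∀ s ∈ Icc (0 : ℝ) 1, 0 < (a + s * (b - a)).im := fun s hs => by
    have ha' : 0 < a.im := ha
    have hb' : 0 < b.im := hb
    have e : (a + s * (b - a)).im = (1 - s) * a.im + s * b.im := by simp; ring
    rw [e]
    rcases hs.1.eq_or_lt with h | h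
    · rw [← h]; simpa using ha'
    · have := mul_nonneg (sub_nonneg.2 hs.2) ha'.le
      have := mul_pos h hb'
      linarith
  -- Along the segment from `a` to `b`, dividing by `b - a` makes the derivative `1 + 1/w`. Its
  -- imaginary part is negative, so `Im γ` strictly decreases and the endpoint values differ.
  let γ : ℝ → ℂ := fun s => ((a + s * (b - a)) + log (a + s * (b - a))) / (b - a)
  have hγ : ∀ s ∈ Icc (0 : ℝ) 1, HasDerivAt γ (1 + (a + s * (b - a))⁻¹) s := fun s hs => by
    have h1 : HasDerivAt (fun s : ℝ => a + (s : ℂ) * (b - a)) (b - a) s := by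
      simpa using ((hasDerivAt_id s).ofReal_comp.mul_const (b - a)).const_add a
    have hsl : a + (s : ℂ) * (b - a) ∈ slitPlane := Or.inr (him s hs).ne'
    refine ((h1.add (h1.clog_real hsl)).div_const (b - a)).congr_deriv ?_
    rw [add_div, div_self hd, div_div, mul_comm, ← div_div, div_self hd, one_div]
  have hγi : ∀ s ∈ Icc (0 : ℝ) 1,
      HasDerivAt (fun s => (γ s).im) (1 + (a + s * (b - a))⁻¹ : ℂ).im s := fun s hs =>
    (imCLM.hasFDerivAt (x := γ s)).comp_hasDerivAt s (hγ s hs)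
  have hanti : StrictAntiOn (fun s => (γ s).im) (Icc 0 1) := by
    refine strictAntiOn_of_deriv_neg (convex_Icc 0 1)
      (fun s hs => (hγi s hs).continuousAt.continuousWithinAt) fun s hs => ?_
    rw [interior_Icc] at hs
    have hs' := Ioo_subset_Icc_self hs
    rw [(hγi s hs').deriv, add_im, one_im, zero_add, inv_im]
    have := him s hs'
    refine div_neg_of_neg_of_pos (by linarith) (normSq_pos.2 fun h => ?_)
    rw [h] at this; simp at this
  have h01 := hanti (left_mem_Icc.2 zero_le_one) (right_mem_Icc.2 zero_le_one) zero_lt_one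
  simp only [γ, ofReal_zero, zero_mul, add_zero, ofReal_one, one_mul, add_sub_cancel] at h01
  simp only at hab
  rw [hab] at h01
  exact lt_irrefl _ h01

/-- Since `w e^w = exp (w + log w)` and `Im (w + log w)` lies in `(0, 2π)`, a value above `π` would
make `Im (w e^w)` negative. In the resulting strip `exp` is injective, which reduces injectivity of
`w e^w` to that of `w + log w`. -/
theorem im_add_log_mem {w : ℂ} (hw : w ∈ lambertUpper) (h : 0 < w.im) :
    0 < (w + log w).im ∧ (w + log w).im ≤ Real.pi := by
  have hw0 : w ≠ 0 := fun h0 => by simp [h0] at h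
  have h1 : 0 < arg w := by
    refine lt_of_le_of_ne (arg_nonneg_iff.2 h.le) fun h2 => ?_
    exact h.ne' ((arg_eq_zero_iff.1 h2.symm).2)
  have h3 : arg w < Real.pi := arg_lt_pi_iff.2 (Or.inr h.ne')
  have hpi := lambertUpper_im_lt_pi hw
  rw [add_im, log_im]
  refine ⟨by positivity, ?_⟩
  by_contra hcon
  push Not at hcon
  have h4 : Real.sin (w.im + arg w) < 0 := by
    have := Real.sin_pos_of_pos_of_lt_pi (x := w.im + arg w - Real.pi) (by linarith) (by linarith)
    rw [Real.sin_sub_pi] at this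
    linarith
  have h5 := hw.2.2
  have e : (w * exp w).im = Real.exp (w + log w).re * Real.sin (w.im + arg w) := by
    have : w * exp w = exp (w + log w) := by rw [exp_add, exp_log hw0, mul_comm]
    rw [this, exp_im, add_im, log_im]
  rw [e] at h5
  have := mul_neg_of_pos_of_neg (Real.exp_pos (w + log w).re) h4
  linarith

theorem strictMonoOn_mul_exp : StrictMonoOn (fun x : ℝ => x * Real.exp x) (Ici (-1)) := by
  refine strictMonoOn_of_deriv_pos (convex_Ici _) (by fun_prop) fun x hx => ?_
  rw [interior_Ici] at hx
  have h : HasDerivAt (fun x : ℝ => x * Real.exp x) ((1 + x) * Real.exp x) x := by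
    refine ((hasDerivAt_id x).mul (Real.hasDerivAt_exp x)).congr_deriv ?_
    simp only [id]; ring
  rw [h.deriv]
  have : -1 < x := hx
  exact mul_pos (by linarith) (Real.exp_pos _)

theorem neg_exp_neg_one_le {x : ℝ} (hx : -1 ≤ x) : -Real.exp (-1) ≤ x * Real.exp x := by
  have := strictMonoOn_mul_exp.monotoneOn (self_mem_Ici (a := (-1 : ℝ))) hx hx
  simpa using this

/-- The point `-v cot v + i v` of the boundary curve. -/
noncomputable def lambertCurve (v : ℝ) : ℂ := ⟨-v * Real.cot v, v⟩

theorem lambertCurve_mem {v : ℝ} (h0 : 0 < v) (hpi : v < Real.pi) :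
    lambertCurve v ∈ lambertUpper :=
  (mem_lambertUpper_iff _).2 (Or.inr ⟨h0, hpi, le_rfl⟩)

theorem lambertCurve_mul_exp {v : ℝ} (h0 : 0 < v) (hpi : v < Real.pi) :
    lambertCurve v * exp (lambertCurve v) = lambertT v := by
  have hs := (Real.sin_pos_of_pos_of_lt_pi h0 hpi).ne'
  have h1 := Real.sin_sq_add_cos_sq v
  apply Complex.ext
  · rw [mul_exp_re, ofReal_re, lambertT]
    simp only [lambertCurve]
    rw [Real.cot_eq_cos_div_sin, mul_comm]
    congr 1
    field_simp
    linear_combination (-1 : ℝ) * h1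
  · rw [mul_exp_im_eq (by exact hs), ofReal_im]
    simp [lambertCurve]

/-- Follows from `v / sin v > 1` and `-v cot v > -1`. It separates the image of the boundary curve
from that of the half-line `[-1, ∞)`, where `w e^w ≥ -1/e`. -/
theorem lambertT_lt {v : ℝ} (h0 : 0 < v) (hpi : v < Real.pi) : lambertT v < -Real.exp (-1) := by
  have hs := Real.sin_pos_of_pos_of_lt_pi h0 hpi
  have h1 : Real.exp (-1) < Real.exp (-v * Real.cot v) :=
    Real.exp_lt_exp.2 (by have := mul_cot_lt_one h0 hpi; linarith)
  have h2 : 1 < v * (Real.sin v)⁻¹ := by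
    rw [← div_eq_mul_inv, one_lt_div hs]; exact Real.sin_lt h0
  have h3 : lambertT v = -(v * (Real.sin v)⁻¹ * Real.exp (-v * Real.cot v)) := by
    rw [lambertT]; ring
  rw [h3, neg_lt_neg_iff]
  have := Real.exp_pos (-v * Real.cot v)
  nlinarith

theorem eq_lambertCurve {w : ℂ} (h0 : 0 < w.im) (hpi : w.im < Real.pi)
    (h : (w * exp w).im = 0) : w = lambertCurve w.im := by
  have hs := Real.sin_pos_of_pos_of_lt_pi h0 hpi
  rw [mul_exp_im_eq hs.ne'] at h
  apply Complex.ext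
  · exact sub_eq_zero.1 ((mul_eq_zero.1 h).resolve_left (by positivity))
  · rfl

theorem eq_ofReal_re {w : ℂ} (h : w.im = 0) : w = (w.re : ℂ) := by
  apply Complex.ext <;> simp [h]

theorem ofReal_mul_exp (x : ℝ) : (x : ℂ) * exp x = ((x * Real.exp x : ℝ) : ℂ) := by
  push_cast; rfl

theorem lambertUpper_im_ne {a b : ℂ} (ha : a ∈ lambertUpper) (hb : b ∈ lambertUpper)
    (h : a * exp a = b * exp b) (ha0 : a.im = 0) : b.im = 0 := by
  by_contra hb0
  have hb1 : 0 < b.im := lt_of_le_of_ne hb.1.1 (Ne.symm hb0)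
  have hpi := lambertUpper_im_lt_pi hb
  have h1 : (b * exp b).im = 0 := by rw [← h, mul_exp_im, ha0]; simp
  have h2 := congrArg re h
  rw [eq_lambertCurve hb1 hpi h1, lambertCurve_mul_exp hb1 hpi, eq_ofReal_re ha0,
    ofReal_mul_exp, ofReal_re, ofReal_re] at h2
  have := neg_exp_neg_one_le ha.2.1
  have := lambertT_lt hb1 hpi
  linarith

theorem injOn_lambertUpper : InjOn (fun w : ℂ => w * exp w) lambertUpper := by
  intro a ha b hb (hab : a * exp a = b * exp b)
  by_cases ha0 : a.im = 0
  · have hb0 := lambertUpper_im_ne ha hb hab ha0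
    rw [eq_ofReal_re ha0, eq_ofReal_re hb0, ofReal_mul_exp, ofReal_mul_exp, ofReal_inj] at hab
    rw [eq_ofReal_re ha0, eq_ofReal_re hb0, strictMonoOn_mul_exp.injOn ha.2.1 hb.2.1 hab]
  · have hb0 : b.im ≠ 0 := fun h => ha0 (lambertUpper_im_ne hb ha hab.symm h)
    have ha1 : 0 < a.im := lt_of_le_of_ne ha.1.1 (Ne.symm ha0)
    have hb1 : 0 < b.im := lt_of_le_of_ne hb.1.1 (Ne.symm hb0)
    refine injOn_add_log ha1 hb1 ?_
    have hane : a ≠ 0 := fun h0 => by simp [h0] at ha0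
    have hbne : b ≠ 0 := fun h0 => by simp [h0] at hb0
    have e : exp (a + log a) = exp (b + log b) := by
      rw [exp_add, exp_log hane, exp_add, exp_log hbne, mul_comm, hab, mul_comm]
    have h1 := im_add_log_mem ha ha1
    have h2 := im_add_log_mem hb hb1
    exact exp_inj_of_neg_pi_lt_of_le_pi (by linarith [Real.pi_pos]) h1.2
      (by linarith [Real.pi_pos]) h2.2 e

/-- This is properness: `Re w ≥ -1` keeps `|e^w|` at least `1/e`. Closedness of the image and
continuity of the inverse rest on it. -/
theorem norm_le_of_mem_lambertUpper {w : ℂ} (hw : w ∈ lambertUpper) :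
    ‖w‖ ≤ Real.exp 1 * ‖w * exp w‖ := by
  rw [norm_mul, norm_exp]
  have h1 : 1 ≤ Real.exp 1 * Real.exp w.re := by
    rw [← Real.exp_add]; exact Real.one_le_exp (by linarith [hw.2.1])
  calc ‖w‖ ≤ ‖w‖ * (Real.exp 1 * Real.exp w.re) := le_mul_of_one_le_right (norm_nonneg _) h1
    _ = _ := by ring

theorem isClosed_image_lambertUpper :
    IsClosed ((fun w : ℂ => w * exp w) '' lambertUpper) := by
  refine isSeqClosed_iff_isClosed.1 fun z z0 hz hlim => ?_
  choose w hw hwz using hz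
  obtain ⟨C, hC⟩ := (Metric.isBounded_range_of_tendsto z hlim).exists_norm_le
  have hb : ∀ n, w n ∈ Metric.closedBall (0 : ℂ) (Real.exp 1 * C) ∩ lambertUpper := fun n => by
    refine ⟨?_, hw n⟩
    rw [mem_closedBall_zero_iff]
    refine (norm_le_of_mem_lambertUpper (hw n)).trans ?_
    have : w n * exp (w n) = z n := hwz n
    rw [this]
    gcongr
    exact hC _ (mem_range_self n)
  obtain ⟨w0, hw0, φ, hφ, hl⟩ :=
    ((isCompact_closedBall (0 : ℂ) (Real.exp 1 * C)).inter_right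
      isClosed_lambertUpper).tendsto_subseq hb
  refine ⟨w0, hw0.2, ?_⟩
  refine tendsto_nhds_unique ((continuous_mul_exp.tendsto w0).comp hl)
    ((hlim.comp hφ.tendsto_atTop).congr fun n => ?_)
  exact (hwz (φ n)).symm

theorem one_add_mul_exp_ne_zero {w : ℂ} (h : w.im ≠ 0) : (1 + w) * exp w ≠ 0 :=
  mul_ne_zero (fun h' => h (by simpa using congrArg im h')) (exp_ne_zero _)

theorem lambertUpper_im_pos {w : ℂ} (hw : w ∈ lambertUpper) (h : 0 < (w * exp w).im) :
    0 < w.im := by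
  refine lt_of_le_of_ne hw.1.1 fun h0 => ?_
  rw [mul_exp_im, ← h0] at h; simp at h

/-- Where `Im (w e^w) > 0`, all inequalities defining `lambertUpper` are strict at `w` and the
derivative `(1 + w) e^w` is nonzero, so the map is locally open. -/
theorem image_lambertUpper_mem_nhds {w : ℂ} (hw : w ∈ lambertUpper) (h : 0 < (w * exp w).im) :
    (fun w : ℂ => w * exp w) '' lambertUpper ∈ 𝓝 (w * exp w) := by
  have h0 := lambertUpper_im_pos hw h
  have hpi := lambertUpper_im_lt_pi hw
  have hre : -1 < w.re := by
    have := (mul_exp_im_pos_iff h0 hpi).1 h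
    have := mul_cot_lt_one h0 hpi
    linarith
  have hstrict : HasStrictDerivAt (fun w : ℂ => w * exp w) ((1 + w) * exp w) w := by
    refine ((hasStrictDerivAt_id w).mul (hasStrictDerivAt_exp w)).congr_deriv ?_
    simp only [id]; ring
  rw [← hstrict.map_nhds_eq (one_add_mul_exp_ne_zero h0.ne')]
  refine image_mem_map ?_
  filter_upwards [(isOpen_lt continuous_const continuous_im).mem_nhds h0,
    (isOpen_lt continuous_im continuous_const).mem_nhds hpi,
    (isOpen_lt continuous_const continuous_re).mem_nhds hre,
    (isOpen_lt continuous_const (continuous_im.comp continuous_mul_exp)).mem_nhds h]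
    with z h1 h2 h3 h4
  exact ⟨⟨le_of_lt h1, le_of_lt h2⟩, le_of_lt h3, le_of_lt h4⟩

theorem upperHalf_subset_image :
    {z : ℂ | 0 ≤ z.im} ⊆ (fun w : ℂ => w * exp w) '' lambertUpper := by
  set T := (fun w : ℂ => w * exp w) '' lambertUpper with hT
  have hopenU : IsOpen {z : ℂ | 0 < z.im} := isOpen_lt continuous_const continuous_im
  -- The part of the image in the open half-plane is open, relatively closed and nonempty (it
  -- contains the image of `1 + iπ/2`), so it is everything by connectedness.
  have hsub : {z : ℂ | 0 < z.im} ⊆ T ∩ {z : ℂ | 0 < z.im} := by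
    refine IsPreconnected.subset_of_closure_inter_subset (convex_halfSpace_im_gt 0).isPreconnected
      ?_ ?_ ?_
    · rw [isOpen_iff_mem_nhds]
      rintro _ ⟨⟨w, hw, rfl⟩, h⟩
      exact inter_mem (image_lambertUpper_mem_nhds hw h) (hopenU.mem_nhds h)
    · have hpi := Real.pi_pos
      have h1 : 0 < ((⟨1, Real.pi / 2⟩ : ℂ) * exp ⟨1, Real.pi / 2⟩).im := by
        rw [mul_exp_im]; simp [Real.exp_pos]
      refine ⟨_, h1, ⟨_, ⟨⟨?_, ?_⟩, ?_, h1.le⟩, rfl⟩, h1⟩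
      · simp only; linarith
      · simp only; linarith
      · norm_num
    · rintro z ⟨hz, hz0⟩
      exact ⟨isClosed_image_lambertUpper.closure_subset (closure_mono inter_subset_left hz), hz0⟩
  have : closure {z : ℂ | 0 < z.im} = {z : ℂ | 0 ≤ z.im} := closure_setOfPred_lt_im 0
  rw [← this]
  exact closure_minimal (hsub.trans inter_subset_left) isClosed_image_lambertUpper

/-! ### Regularity and growth of `W` -/

theorem lambertW_mem_and_eq {z : ℂ} (hz : 0 ≤ z.im) :
    lambertW z ∈ lambertUpper ∧ lambertW z * exp (lambertW z) = z := by
  obtain ⟨w, hw, hwz⟩ := upperHalf_subset_image hz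
  have hex : ∃ a ∈ lambertRange, (fun w : ℂ => w * exp w) a = z :=
    ⟨w, lambertUpper_subset hw, hwz⟩
  have h1 : lambertW z ∈ lambertRange := Function.invFunOn_mem hex
  have h2 : lambertW z * exp (lambertW z) = z := Function.invFunOn_eq hex
  refine ⟨(lambertRange_cases h1).resolve_right fun h => ?_, h2⟩
  rw [h2] at h
  exact absurd h.2 (not_lt.2 hz)

theorem lambertW_eq_of_mem {w : ℂ} (hw : w ∈ lambertUpper) : lambertW (w * exp w) = w := by
  have := lambertW_mem_and_eq hw.2.2
  exact injOn_lambertUpper this.1 hw this.2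

theorem lambertW_conj {z : ℂ} (hz : 0 < z.im) : lambertW (conj z) = conj (lambertW z) := by
  obtain ⟨hw, hwz⟩ := lambertW_mem_and_eq hz.le
  have hpos : 0 < (lambertW z * exp (lambertW z)).im := by rwa [hwz]
  have hex : ∃ a ∈ lambertRange, (fun w : ℂ => w * exp w) a = conj z :=
    ⟨conj (lambertW z), conj_mem_lambertRange hw hpos, by
      simp only [conj_mul_exp, hwz]⟩
  have h1 : lambertW (conj z) ∈ lambertRange := Function.invFunOn_mem hex
  have h2 : lambertW (conj z) * exp (lambertW (conj z)) = conj z := Function.invFunOn_eq hex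
  rcases lambertRange_cases h1 with h | h
  · have := h.2.2
    rw [h2, conj_im] at this
    linarith
  · have h3 : conj (lambertW (conj z)) = lambertW z := by
      refine injOn_lambertUpper h.1 hw ?_
      simp only [conj_mul_exp, h2, hwz, conj_conj]
    rw [← h3, conj_conj]

/-- Near `z0` the values stay in a compact set, and any cluster value `w` satisfies `w e^w = z0`;
injectivity leaves only `W(z0)`. -/
theorem continuousOn_lambertW : ContinuousOn lambertW {z : ℂ | 0 ≤ z.im} := by
  intro z0 hz0
  have hK : IsCompact (Metric.closedBall (0 : ℂ) (Real.exp 1 * (‖z0‖ + 1)) ∩ lambertUpper) :=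
    (isCompact_closedBall _ _).inter_right isClosed_lambertUpper
  refine hK.tendsto_nhds_of_unique_mapClusterPt ?_ fun w hw hcl => ?_
  · filter_upwards [self_mem_nhdsWithin, nhdsWithin_le_nhds
      ((continuous_norm.tendsto z0).eventually_lt_const (lt_add_one ‖z0‖))] with z hz hn
    obtain ⟨h1, h2⟩ := lambertW_mem_and_eq hz
    refine ⟨?_, h1⟩
    rw [mem_closedBall_zero_iff]
    refine (norm_le_of_mem_lambertUpper h1).trans ?_
    rw [h2]
    gcongr
  · have h1 : MapClusterPt (w * exp w) (𝓝[{z : ℂ | 0 ≤ z.im}] z0)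
        ((fun w : ℂ => w * exp w) ∘ lambertW) :=
      hcl.tendsto_comp (continuous_mul_exp.tendsto w)
    have h2 : Tendsto ((fun w : ℂ => w * exp w) ∘ lambertW) (𝓝[{z : ℂ | 0 ≤ z.im}] z0)
        (𝓝 z0) := by
      refine (tendsto_id.mono_left nhdsWithin_le_nhds).congr' ?_
      filter_upwards [self_mem_nhdsWithin] with z hz
      exact (lambertW_mem_and_eq hz).2.symm
    have h3 : w * exp w = z0 := by
      have h4 : ClusterPt (w * exp w) (𝓝 z0) := ClusterPt.mono h1 h2
      exact eq_of_nhds_neBot h4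
    rw [← h3, lambertW_eq_of_mem hw.2]

theorem lambertW_im_pos {z : ℂ} (hz : 0 < z.im) : 0 < (lambertW z).im := by
  obtain ⟨h1, h2⟩ := lambertW_mem_and_eq hz.le
  exact lambertUpper_im_pos h1 (by rwa [h2])

theorem differentiableOn_lambertW : DifferentiableOn ℂ lambertW {z : ℂ | 0 < z.im} := by
  intro z hz
  have hz' : 0 < z.im := hz
  have hnhds : {z : ℂ | 0 < z.im} ∈ 𝓝 z :=
    (isOpen_lt continuous_const continuous_im).mem_nhds hz
  have hc : ContinuousAt lambertW z :=
    continuousOn_lambertW.continuousAt (mem_of_superset hnhds fun z (h : 0 < z.im) => h.le)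
  have := (hasDerivAt_mul_exp (lambertW z)).of_local_left_inverse hc
    (one_add_mul_exp_ne_zero (lambertW_im_pos hz').ne')
    (mem_of_superset hnhds fun z (h : 0 < z.im) => (lambertW_mem_and_eq h.le).2)
  exact this.differentiableAt.differentiableWithinAt

theorem lambertW_lambertT {v : ℝ} (h0 : 0 < v) (hpi : v < Real.pi) :
    lambertW (lambertT v) = lambertCurve v := by
  rw [← lambertCurve_mul_exp h0 hpi]
  exact lambertW_eq_of_mem (lambertCurve_mem h0 hpi)

theorem injOn_lambertT : InjOn lambertT (Ioo 0 Real.pi) := fun a ha b hb h => by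
  have := lambertW_lambertT ha.1 ha.2
  rw [h, lambertW_lambertT hb.1 hb.2] at this
  exact (congrArg im this).symm

theorem exists_lambertT_eq_of_im_ne_zero {t : ℝ} (h : (lambertW t).im ≠ 0) :
    ∃ v ∈ Ioo 0 Real.pi, lambertT v = t := by
  obtain ⟨h1, h2⟩ := lambertW_mem_and_eq (z := t) (by simp)
  have h0 := lt_of_le_of_ne h1.1.1 h.symm
  have hpi := lambertUpper_im_lt_pi h1
  refine ⟨_, ⟨h0, hpi⟩, ?_⟩
  have h3 := eq_lambertCurve h0 hpi (by rw [h2]; simp)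
  have h4 := lambertCurve_mul_exp h0 hpi
  rw [← h3, h2] at h4
  exact_mod_cast h4.symm

theorem lambertW_im_eq_zero {t : ℝ} (h : -Real.exp (-1) ≤ t) : (lambertW t).im = 0 := by
  by_contra h0
  obtain ⟨v, hv, rfl⟩ := exists_lambertT_eq_of_im_ne_zero h0
  exact absurd (lambertT_lt hv.1 hv.2) (not_lt.2 h)

theorem tendsto_lambertW_cobounded :
    Tendsto lambertW upperInfty (Bornology.cobounded ℂ) := by
  have hH : ∀ᶠ z in upperInfty, 0 ≤ z.im := mem_inf_of_right (mem_principal_self _)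
  rw [← tendsto_norm_atTop_iff_cobounded]
  have h1 : Tendsto (fun z : ℂ => ‖z‖) upperInfty atTop :=
    tendsto_norm_cobounded_atTop.mono_left inf_le_left
  refine tendsto_atTop.2 fun C => ?_
  filter_upwards [hH, h1.eventually_gt_atTop (C * Real.exp C)] with z hz hn
  by_contra hC
  push Not at hC
  rw [← (lambertW_mem_and_eq hz).2, norm_mul, norm_exp] at hn
  have h2 : (lambertW z).re ≤ C := ((le_abs_self _).trans (abs_re_le_norm _)).trans hC.le
  have : ‖lambertW z‖ * Real.exp (lambertW z).re ≤ C * Real.exp C := by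
    gcongr
    exact (norm_nonneg _).trans hC.le
  linarith

/-- `Im W` stays in `[0, π]` and `Re W ≥ -1`, so `|W| → ∞` forces `Re W → +∞`. -/
theorem tendsto_lambertW_re : Tendsto (fun z => (lambertW z).re) upperInfty atTop := by
  have hH : ∀ᶠ z in upperInfty, 0 ≤ z.im := mem_inf_of_right (mem_principal_self _)
  have h1 := tendsto_norm_atTop_iff_cobounded.2 tendsto_lambertW_cobounded
  refine tendsto_atTop.2 fun C => ?_
  filter_upwards [hH, h1.eventually_gt_atTop (|C| + 1 + Real.pi)] with z hz hn
  obtain ⟨h2, _⟩ := lambertW_mem_and_eq hz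
  have h3 := norm_le_abs_re_add_abs_im (lambertW z)
  rw [abs_of_nonneg h2.1.1] at h3
  have h4 : |C| + 1 < |(lambertW z).re| := by linarith [h2.1.2]
  rcases abs_cases (lambertW z).re with h | h
  · linarith [le_abs_self C]
  · linarith [h2.2.1, abs_nonneg C]

theorem isLittleO_lambertW : lambertW =o[upperInfty] fun z => z := by
  have hH : ∀ᶠ z in upperInfty, 0 ≤ z.im := mem_inf_of_right (mem_principal_self _)
  rw [isLittleO_iff]
  intro c hc
  have h1 := (Real.tendsto_exp_atTop.comp tendsto_lambertW_re).eventually_ge_atTop c⁻¹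
  filter_upwards [hH, h1] with z hz hn
  obtain ⟨_, h2⟩ := lambertW_mem_and_eq hz
  have h3 : ‖z‖ = ‖lambertW z‖ * Real.exp (lambertW z).re := by
    rw [← norm_exp, ← norm_mul, h2]
  rw [h3]
  simp only [Function.comp] at hn
  calc ‖lambertW z‖ = c * (‖lambertW z‖ * c⁻¹) := by field_simp
    _ ≤ _ := by gcongr

theorem isLittleO_exp_lambertW : (fun z => exp (lambertW z)) =o[upperInfty] fun z => z := by
  have hH : ∀ᶠ z in upperInfty, 0 ≤ z.im := mem_inf_of_right (mem_principal_self _)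
  have h1 := tendsto_norm_atTop_iff_cobounded.2 tendsto_lambertW_cobounded
  rw [isLittleO_iff]
  intro c hc
  filter_upwards [hH, h1.eventually_ge_atTop c⁻¹] with z hz hn
  obtain ⟨_, h2⟩ := lambertW_mem_and_eq hz
  have h3 : ‖z‖ = ‖lambertW z‖ * ‖exp (lambertW z)‖ := by rw [← norm_mul, h2]
  rw [h3]
  calc ‖exp (lambertW z)‖ = c * (c⁻¹ * ‖exp (lambertW z)‖) := by field_simp
    _ ≤ _ := by gcongr

theorem isLittleO_exp_neg_lambertW :
    (fun z => -exp (-lambertW z)) =o[upperInfty] fun z => z := by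
  have hH : ∀ᶠ z in upperInfty, 0 ≤ z.im := mem_inf_of_right (mem_principal_self _)
  have hone : (fun _ : ℂ => (1 : ℂ)) =o[upperInfty] fun z => z :=
    (isLittleO_const_id_cobounded (1 : ℂ)).mono inf_le_left
  refine IsBigO.trans_isLittleO (IsBigO.of_bound (Real.exp 1) ?_) hone
  filter_upwards [hH] with z hz
  obtain ⟨h1, _⟩ := lambertW_mem_and_eq hz
  rw [norm_neg, norm_exp, norm_one, mul_one, neg_re]
  exact Real.exp_le_exp.2 (by linarith [h1.2.1])

theorem lambertW_mul_exp (z : ℂ) : lambertW z * exp (lambertW z) = z := by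
  rcases le_or_gt 0 z.im with h | h
  · exact (lambertW_mem_and_eq h).2
  · have h' : 0 < (conj z).im := by simpa using h
    have h1 := lambertW_conj h'
    rw [conj_conj] at h1
    rw [h1, conj_mul_exp, (lambertW_mem_and_eq h'.le).2, conj_conj]

theorem lambertW_ne_zero {z : ℂ} (hz : z ≠ 0) : lambertW z ≠ 0 := fun h => by
  have := lambertW_mul_exp z
  rw [h, zero_mul] at this
  exact hz this.symm

theorem lambertW_div_self {z : ℂ} (hz : z ≠ 0) : lambertW z / z = exp (-lambertW z) := by
  rw [div_eq_iff hz, exp_neg, inv_mul_eq_div, eq_div_iff (exp_ne_zero _), lambertW_mul_exp]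

theorem self_div_lambertW {z : ℂ} (hz : z ≠ 0) : z / lambertW z = exp (lambertW z) := by
  rw [div_eq_iff (lambertW_ne_zero hz), mul_comm, lambertW_mul_exp]

/-! ### The substitution `t = t(v)` and the integral representations -/

theorem lambertT_eq (v : ℝ) :
    lambertT v = -v * (Real.sin v)⁻¹ * Real.exp (-v * (Real.cos v / Real.sin v)) := by
  rw [lambertT, Real.cot_eq_cos_div_sin]

theorem lambertT_neg {v : ℝ} (hv : v ∈ Ioo 0 Real.pi) : lambertT v < 0 :=
  (lambertT_lt hv.1 hv.2).trans (by simpa using Real.exp_pos (-1))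

theorem hasDerivAt_lambertT {v : ℝ} (hv : v ∈ Ioo 0 Real.pi) :
    HasDerivAt lambertT (lambertT v * (v ^ 2 + (1 - v * Real.cot v) ^ 2) / v) v := by
  have hs := (Real.sin_pos_of_pos_of_lt_pi hv.1 hv.2).ne'
  have hv0 := hv.1.ne'
  have h1 : HasDerivAt (fun v : ℝ => -v) (-1) v := (hasDerivAt_id v).neg
  have h2 := (h1.mul ((Real.hasDerivAt_sin v).inv hs)).mul
    ((h1.mul ((Real.hasDerivAt_cos v).div (Real.hasDerivAt_sin v) hs)).exp)
  rw [funext lambertT_eq]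
  refine h2.congr_deriv ?_
  simp only [Pi.mul_apply, Pi.inv_apply, Pi.div_apply]
  rw [Real.cot_eq_cos_div_sin]
  set E := Real.exp (-v * (Real.cos v / Real.sin v))
  field_simp
  ring

theorem lambertK_eq (z : ℂ) (v : ℝ) :
    lambertK z v = -((v ^ 2 + (1 - v * Real.cot v) ^ 2 : ℝ) : ℂ) * pickKernel z (lambertT v) := by
  have e : z - (lambertT v : ℂ) = -((lambertT v : ℂ) - z) := by ring
  rw [lambertK, pickKernel, e]
  push_cast
  rw [neg_mul, div_neg, ← mul_div_assoc, neg_mul, neg_div]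
  congr 2
  ring

theorem abs_deriv_lambertT {v : ℝ} (hv : v ∈ Ioo 0 Real.pi) :
    |lambertT v * (v ^ 2 + (1 - v * Real.cot v) ^ 2) / v| =
      -lambertT v / v * (v ^ 2 + (1 - v * Real.cot v) ^ 2) := by
  have h1 := lambertT_neg hv
  have h2 := hv.1
  rw [abs_of_nonpos]
  · ring
  · exact div_nonpos_of_nonpos_of_nonneg
      (mul_nonpos_of_nonpos_of_nonneg h1.le (by positivity)) h2.le

section
variable {g : ℂ → ℂ}

theorem im_eq_zero_of_conj (hgc : ∀ w, g (conj w) = conj (g w)) {w : ℂ} (hw : w.im = 0) :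
    (g w).im = 0 := by
  have h1 : conj w = w := conj_eq_iff_im.2 hw
  exact conj_eq_iff_im.1 (by rw [← hgc, h1])

theorem mem_image_of_im_ne_zero (hgc : ∀ w, g (conj w) = conj (g w)) {t : ℝ}
    (ht : (g (lambertW t)).im ≠ 0) : t ∈ lambertT '' Ioo 0 Real.pi :=
  exists_lambertT_eq_of_im_ne_zero fun h => ht (im_eq_zero_of_conj hgc h)

/-- The representation of `g ∘ W` on the cut plane, in the variable `v`. -/
theorem comp_lambertW_eq (hg : Differentiable ℂ g) (hgc : ∀ w, g (conj w) = conj (g w))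
    (ho : (fun z => g (lambertW z)) =o[upperInfty] fun z => z)
    (hint : Integrable fun t : ℝ => (g (lambertW t)).im * (1 + t ^ 2)⁻¹) {q : ℝ → ℝ}
    (hq : ∀ v ∈ Ioo 0 Real.pi, -lambertT v / v * (g (lambertCurve v)).im = q v)
    {z : ℂ} (hz : z ∈ slitPlane) :
    IntervalIntegrable (fun v : ℝ => lambertK z v * (q v : ℂ)) volume 0 Real.pi ∧
      g (lambertW z) = ((g (lambertW I)).re : ℂ) -
        1 / (Real.pi : ℂ) * ∫ v in (0 : ℝ)..Real.pi, lambertK z v * (q v : ℂ) := by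
  have hc : ContinuousOn (fun z => g (lambertW z)) {z : ℂ | 0 ≤ z.im} :=
    hg.continuous.comp_continuousOn continuousOn_lambertW
  have h0 : ∀ t : ℝ, 0 ≤ t → (g (lambertW t)).im = 0 := fun t ht =>
    im_eq_zero_of_conj hgc (lambertW_im_eq_zero
      ((neg_nonpos.2 (Real.exp_pos _).le).trans ht))
  have hrep := eq_add_integral_pickKernel_of_mem_slitPlane (f := fun z => g (lambertW z)) hc
    (hg.comp_differentiableOn differentiableOn_lambertW) ho hint h0
    (fun z hz => by simp only [lambertW_conj hz, hgc]) hz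
  have hi := integrable_im_mul_pickKernel (f := fun z => g (lambertW z)) (hc.comp_continuous
    continuous_ofReal fun x => by simp) hint (z := z) (Or.inl h0) fun t ht h => by
      have hzt := sub_eq_zero.1 h
      rw [← hzt, ofReal_mem_slitPlane] at hz
      linarith
  have hpt : ∀ v ∈ Ioo 0 Real.pi, |lambertT v * (v ^ 2 + (1 - v * Real.cot v) ^ 2) / v| •
      (((g (lambertW (lambertT v))).im : ℂ) * pickKernel z (lambertT v)) =
      -(lambertK z v * (q v : ℂ)) := fun v hv => by
    rw [abs_deriv_lambertT hv, lambertW_lambertT hv.1 hv.2, lambertK_eq, ← hq v hv, real_smul]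
    push_cast
    ring
  have hd : ∀ v ∈ Ioo 0 Real.pi, HasDerivWithinAt lambertT
      (lambertT v * (v ^ 2 + (1 - v * Real.cot v) ^ 2) / v) (Ioo 0 Real.pi) v := fun v hv =>
    (hasDerivAt_lambertT hv).hasDerivWithinAt
  constructor
  · rw [intervalIntegrable_iff_integrableOn_Ioo_of_le Real.pi_pos.le]
    have h1 := (integrableOn_image_iff_integrableOn_abs_deriv_smul measurableSet_Ioo hd
      injOn_lambertT _).1 hi.integrableOn
    refine ((integrableOn_congr_fun hpt measurableSet_Ioo).1 h1).neg.congr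
      (Eventually.of_forall fun v => ?_)
    simp
  -- The integrand vanishes off the image of `lambertT`, so the integral over the line may be
  -- restricted to that image before substituting.
  · rw [hrep, intervalIntegral.integral_of_le Real.pi_pos.le, integral_Ioc_eq_integral_Ioo,
      ← setIntegral_eq_integral_of_forall_compl_eq_zero (s := lambertT '' Ioo 0 Real.pi)
        (fun t ht => ?_),
      integral_image_eq_integral_abs_deriv_smul measurableSet_Ioo hd injOn_lambertT,
      setIntegral_congr_fun measurableSet_Ioo hpt, integral_neg]
    · ring
    · have : (g (lambertW t)).im = 0 := by
        by_contra h
        exact ht (mem_image_of_im_ne_zero hgc h)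
      simp [this]

end

theorem continuous_lambertW_ofReal : Continuous fun t : ℝ => lambertW t :=
  continuousOn_lambertW.comp_continuous continuous_ofReal fun x => by simp

theorem integrable_mul_inv_one_add_sq {m : ℝ → ℝ} {C : ℝ} (hm : Continuous m)
    (hC : ∀ t, |m t| ≤ C) : Integrable fun t : ℝ => m t * (1 + t ^ 2)⁻¹ :=
  integrable_inv_one_add_sq.bdd_mul (c := C) hm.aestronglyMeasurable (Eventually.of_forall hC)

theorem integrable_lambertW_im :
    Integrable fun t : ℝ => (lambertW t).im * (1 + t ^ 2)⁻¹ := by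
  refine integrable_mul_inv_one_add_sq (C := Real.pi)
    (continuous_im.comp continuous_lambertW_ofReal) fun t => ?_
  obtain ⟨h, _⟩ := lambertW_mem_and_eq (z := t) (by simp)
  rw [abs_of_nonneg h.1.1]
  exact h.1.2

theorem integrable_exp_neg_lambertW_im :
    Integrable fun t : ℝ => (-exp (-lambertW t)).im * (1 + t ^ 2)⁻¹ := by
  refine integrable_mul_inv_one_add_sq (C := Real.exp 1)
    (continuous_im.comp (continuous_exp.comp continuous_lambertW_ofReal.neg).neg) fun t => ?_
  obtain ⟨h, _⟩ := lambertW_mem_and_eq (z := t) (by simp)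
  refine (abs_im_le_norm _).trans ?_
  rw [norm_neg, norm_exp, neg_re]
  exact Real.exp_le_exp.2 (by linarith [h.2.1])

theorem lambertCurve_weight {v : ℝ} (hv : v ∈ Ioo 0 Real.pi) :
    -lambertT v / v * (exp (lambertCurve v)).im = Real.exp (-2 * v * Real.cot v) := by
  have hs := (Real.sin_pos_of_pos_of_lt_pi hv.1 hv.2).ne'
  have hv0 := hv.1.ne'
  rw [exp_im, lambertT]
  simp only [lambertCurve]
  have e : Real.exp (-2 * v * Real.cot v) =
      Real.exp (-v * Real.cot v) * Real.exp (-v * Real.cot v) := by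
    rw [← Real.exp_add]; ring_nf
  rw [e]
  field_simp

theorem measurable_cot : Measurable Real.cot := by
  have : Real.cot = fun x => Real.cos x / Real.sin x := funext Real.cot_eq_cos_div_sin
  rw [this]
  exact Real.measurable_cos.div Real.measurable_sin

theorem exp_mul_le_lambertT_sq {v : ℝ} (hv : v ∈ Ioo 0 Real.pi) :
    Real.exp (-2 * v * Real.cot v) * (v ^ 2 + (1 - v * Real.cot v) ^ 2) ≤
      5 * (1 + lambertT v ^ 2) := by
  have hs := Real.sin_pos_of_pos_of_lt_pi hv.1 hv.2
  have hv0 := hv.1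
  have e : Real.exp (-2 * v * Real.cot v) = Real.exp (-v * Real.cot v) ^ 2 := by
    rw [← Real.exp_nat_mul]; push_cast; ring_nf
  -- After multiplication by `sin² v`, the two squares are at most `v²` and `(2v)²`, whence the
  -- factor `5`.
  have h1 : v ^ 2 + (1 - v * Real.cot v) ^ 2 ≤ 5 * (-v * (Real.sin v)⁻¹) ^ 2 := by
    have h2 : Real.sin v ≤ v := Real.sin_le hv0.le
    have h3 : 0 ≤ Real.sin v - v * Real.cos v := (sub_pos.2 (mul_cos_lt_sin hv.1 hv.2)).le
    have h4 : Real.sin v - v * Real.cos v ≤ 2 * v := by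
      nlinarith [Real.neg_one_le_cos v]
    have h5 := Real.sin_sq_le_one v
    have e2 : v ^ 2 + (1 - v * Real.cot v) ^ 2 =
        (v ^ 2 * Real.sin v ^ 2 + (Real.sin v - v * Real.cos v) ^ 2) / Real.sin v ^ 2 := by
      rw [Real.cot_eq_cos_div_sin]; field_simp
    have e3 : 5 * (-v * (Real.sin v)⁻¹) ^ 2 = (5 * v ^ 2) / Real.sin v ^ 2 := by
      field_simp
    rw [e2, e3]
    have h6 : v ^ 2 * Real.sin v ^ 2 ≤ v ^ 2 * 1 := by gcongr
    have h7 : (Real.sin v - v * Real.cos v) ^ 2 ≤ (2 * v) ^ 2 := by gcongr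
    gcongr
    linarith
  calc _ ≤ Real.exp (-v * Real.cot v) ^ 2 * (5 * (-v * (Real.sin v)⁻¹) ^ 2) := by
        rw [e]; gcongr
    _ = 5 * lambertT v ^ 2 := by rw [lambertT]; ring
    _ ≤ _ := by linarith

/-- Here `Im e^W` is unbounded on the cut, unlike in the two other cases. In the variable `v`,
however, the integrand is at most `5` on a bounded interval. -/
theorem integrable_exp_lambertW_im :
    Integrable fun t : ℝ => (exp (lambertW t)).im * (1 + t ^ 2)⁻¹ := by
  have hgc : ∀ w, exp (conj w) = conj (exp w) := fun w => (exp_conj w)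
  have hd : ∀ v ∈ Ioo 0 Real.pi, HasDerivWithinAt lambertT
      (lambertT v * (v ^ 2 + (1 - v * Real.cot v) ^ 2) / v) (Ioo 0 Real.pi) v := fun v hv =>
    (hasDerivAt_lambertT hv).hasDerivWithinAt
  have hpt : ∀ v ∈ Ioo 0 Real.pi, |lambertT v * (v ^ 2 + (1 - v * Real.cot v) ^ 2) / v| •
      ((exp (lambertW (lambertT v))).im * (1 + lambertT v ^ 2)⁻¹) =
      Real.exp (-2 * v * Real.cot v) * (v ^ 2 + (1 - v * Real.cot v) ^ 2) *
        (1 + lambertT v ^ 2)⁻¹ := fun v hv => by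
    rw [abs_deriv_lambertT hv, lambertW_lambertT hv.1 hv.2, ← lambertCurve_weight hv, smul_eq_mul]
    ring
  have hon : IntegrableOn (fun t : ℝ => (exp (lambertW t)).im * (1 + t ^ 2)⁻¹)
      (lambertT '' Ioo 0 Real.pi) := by
    rw [integrableOn_image_iff_integrableOn_abs_deriv_smul measurableSet_Ioo hd injOn_lambertT,
      integrableOn_congr_fun hpt measurableSet_Ioo]
    have hcot := measurable_cot
    have hm : Measurable fun v => Real.exp (-2 * v * Real.cot v) *
        (v ^ 2 + (1 - v * Real.cot v) ^ 2) * (1 + lambertT v ^ 2)⁻¹ := by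
      unfold lambertT; fun_prop
    refine Measure.integrableOn_of_bounded (M := 5) (by simp) hm.aestronglyMeasurable ?_
    filter_upwards [ae_restrict_mem measurableSet_Ioo] with v hv
    rw [Real.norm_of_nonneg (by positivity), ← div_eq_mul_inv, div_le_iff₀ (by positivity)]
    exact exp_mul_le_lambertT_sq hv
  refine (integrableOn_iff_integrable_of_support_subset fun t ht => ?_).1 hon
  exact mem_image_of_im_ne_zero hgc fun h => ht (by simp [h])

theorem lambertW_representation {z : ℂ} (hz : z ∈ slitPlane) :
    IntervalIntegrable (fun v : ℝ => lambertK z v * (lambertT v : ℂ)) volume 0 Real.pi ∧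
      lambertW z = ((lambertW I).re : ℂ) +
        1 / (Real.pi : ℂ) * ∫ v in (0 : ℝ)..Real.pi, lambertK z v * (lambertT v : ℂ) := by
  obtain ⟨h1, h2⟩ := comp_lambertW_eq (g := id) (q := fun v => -lambertT v) differentiable_id
    (fun _ => rfl) isLittleO_lambertW integrable_lambertW_im (fun v hv => by
      have := hv.1.ne'
      simp only [id, lambertCurve]; field_simp) hz
  simp only [ofReal_neg, mul_neg, intervalIntegral.integral_neg, sub_neg_eq_add, id] at h1 h2
  refine ⟨?_, h2⟩
  exact h1.neg.congr fun v _ => by simp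

theorem exp_neg_lambertW_representation {z : ℂ} (hz : z ∈ slitPlane) :
    IntervalIntegrable (fun v : ℝ => lambertK z v) volume 0 Real.pi ∧
      exp (-lambertW z) = ((exp (-lambertW I)).re : ℂ) +
        1 / (Real.pi : ℂ) * ∫ v in (0 : ℝ)..Real.pi, lambertK z v := by
  obtain ⟨h1, h2⟩ := comp_lambertW_eq (g := fun w => -exp (-w)) (q := fun _ => 1)
    (differentiable_exp.comp differentiable_id.neg).neg
    (fun w => by rw [← map_neg, exp_conj, ← map_neg]) isLittleO_exp_neg_lambertW
    integrable_exp_neg_lambertW_im (fun v hv => by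
      have hs := (Real.sin_pos_of_pos_of_lt_pi hv.1 hv.2).ne'
      have hv0 := hv.1.ne'
      rw [neg_im, exp_im, neg_re, neg_im, Real.sin_neg, lambertT]
      simp only [lambertCurve]
      rw [Real.exp_neg]
      field_simp) hz
  simp only [ofReal_one, mul_one] at h1 h2
  refine ⟨h1, ?_⟩
  rw [neg_re, ofReal_neg] at h2
  linear_combination (-1 : ℂ) * h2

theorem exp_lambertW_representation {z : ℂ} (hz : z ∈ slitPlane) :
    IntervalIntegrable (fun v : ℝ => lambertK z v * ((Real.exp (-2 * v * Real.cot v) : ℝ) : ℂ))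
        volume 0 Real.pi ∧
      exp (lambertW z) = ((exp (lambertW I)).re : ℂ) -
        1 / (Real.pi : ℂ) * ∫ v in (0 : ℝ)..Real.pi,
          lambertK z v * ((Real.exp (-2 * v * Real.cot v) : ℝ) : ℂ) :=
  comp_lambertW_eq (g := exp) (q := fun v => Real.exp (-2 * v * Real.cot v))
    differentiable_exp (fun w => exp_conj w) isLittleO_exp_lambertW integrable_exp_lambertW_im
    (fun _ hv => lambertCurve_weight hv) hz

/-! ### `W` as a Pick function -/

theorem isPickFunction_lambertW : IsPickFunction lambertW :=
  ⟨differentiableOn_lambertW, fun _ hz => (lambertW_im_pos hz).le⟩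

theorem hasPickRepresentation_lambertW :
    HasPickRepresentation lambertW (lambertW I).re 0 lambertPickMeasure := by
  have him : ∀ t : ℝ, 0 ≤ (lambertW t).im / Real.pi := fun t =>
    div_nonneg (lambertW_mem_and_eq (z := t) (by simp)).1.1.1 Real.pi_pos.le
  have hm : Measurable fun t : ℝ => ENNReal.ofReal ((lambertW (t : ℂ)).im / Real.pi) :=
    ((continuous_im.comp continuous_lambertW_ofReal).measurable.div_const _).ennreal_ofReal
  refine ⟨le_rfl, ?_, fun z hz => ?_⟩
  · rw [lambertPickMeasure, integrable_withDensity_iff_integrable_smul' hm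
      (Eventually.of_forall fun _ => ENNReal.ofReal_lt_top)]
    refine (integrable_lambertW_im.div_const Real.pi).congr (Eventually.of_forall fun t => ?_)
    simp only
    rw [ENNReal.toReal_ofReal (him t), smul_eq_mul]
    ring
  · have h := eq_add_integral_pickKernel continuousOn_lambertW differentiableOn_lambertW
      isLittleO_lambertW integrable_lambertW_im hz
    rw [lambertPickMeasure, integral_withDensity_eq_integral_toReal_smul hm
      (Eventually.of_forall fun _ => ENNReal.ofReal_lt_top), h, ← integral_const_mul]
    simp only [ofReal_zero, zero_mul, add_zero]
    congr 1
    refine integral_congr_ae (Eventually.of_forall fun t => ?_)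
    simp only
    rw [ENNReal.toReal_ofReal (him t), real_smul, pickKernel]
    push_cast
    ring

/-! ### Numerical values of the constants -/

theorem abs_cos_sub_taylor_le_and_abs_sin_sub_taylor_le {x : ℝ} (h0 : 0 ≤ x) (h1 : x ≤ 1) :
    |Real.cos x - (1 - x ^ 2 / 2 + x ^ 4 / 24 - x ^ 6 / 720 + x ^ 8 / 40320 - x ^ 10 / 3628800)| ≤
        x ^ 12 * (13 / 5748019200) ∧
      |Real.sin x - (x - x ^ 3 / 6 + x ^ 5 / 120 - x ^ 7 / 5040 + x ^ 9 / 362880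
        - x ^ 11 / 39916800)| ≤ x ^ 12 * (13 / 5748019200) := by
  have hn : ‖(x : ℂ) * I‖ = x := by simp [abs_of_nonneg h0]
  have h := Complex.exp_bound (x := x * I) (by rw [hn]; exact h1) (n := 12) (by norm_num)
  rw [hn] at h
  have i2 : I ^ 2 = -1 := I_sq
  have i3 : I ^ 3 = -I := by rw [pow_succ, I_sq]; ring
  have i4 : I ^ 4 = 1 := I_pow_four
  have i5 : I ^ 5 = I := by rw [pow_succ, i4]; ring
  have i6 : I ^ 6 = -1 := by rw [pow_succ, i5, ← pow_two, i2]
  have i7 : I ^ 7 = -I := by rw [pow_succ, i6]; ring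
  have i8 : I ^ 8 = 1 := by rw [show 8 = 4 * 2 by norm_num, pow_mul, i4, one_pow]
  have i9 : I ^ 9 = I := by rw [pow_succ, i8]; ring
  have i10 : I ^ 10 = -1 := by rw [pow_succ, i9, ← pow_two, i2]
  have i11 : I ^ 11 = -I := by rw [pow_succ, i10]; ring
  have e : exp (x * I) - ∑ m ∈ Finset.range 12, ((x : ℂ) * I) ^ m / m.factorial =
      ((Real.cos x - (1 - x ^ 2 / 2 + x ^ 4 / 24 - x ^ 6 / 720 + x ^ 8 / 40320
        - x ^ 10 / 3628800) : ℝ) : ℂ) +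
      ((Real.sin x - (x - x ^ 3 / 6 + x ^ 5 / 120 - x ^ 7 / 5040 + x ^ 9 / 362880
        - x ^ 11 / 39916800) : ℝ) : ℂ) * I := by
    rw [exp_mul_I, ← ofReal_cos, ← ofReal_sin]
    simp only [Finset.sum_range_succ, Finset.sum_range_zero, mul_pow, i2, i3, i4, i5, i6, i7, i8,
      i9, i10, i11, Nat.factorial]
    push_cast
    ring
  rw [e] at h
  -- The remainder constant of `Complex.exp_bound` for twelve terms is `13 / (12! · 12)`.
  have hb : x ^ 12 * (((12 : ℕ).succ : ℝ) * ((Nat.factorial 12 : ℝ) * (12 : ℕ))⁻¹) =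
      x ^ 12 * (13 / 5748019200) := by
    norm_num [Nat.factorial]
  rw [hb] at h
  refine ⟨le_trans ?_ ((abs_re_le_norm _).trans h), le_trans ?_ ((abs_im_le_norm _).trans h)⟩ <;>
  simp only [add_re, add_im, re_ofReal_mul, im_ofReal_mul, I_re, I_im, ofReal_re, ofReal_im,
    mul_zero, mul_one, add_zero, zero_add, le_refl]

/-- With `w = a + i b` and `w e ^ w = i`: `a = b tan b` and `e ^ a b / cos b = 1`. -/
theorem lambertW_I_equations : 0 < (lambertW I).im ∧ (lambertW I).im < Real.pi / 2 ∧
    (lambertW I).re = (lambertW I).im * Real.sin (lambertW I).im / Real.cos (lambertW I).im ∧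
    Real.exp (-(lambertW I).re) = (lambertW I).im / Real.cos (lambertW I).im := by
  obtain ⟨hU, hw⟩ := lambertW_mem_and_eq (z := I) (by simp)
  have hb : 0 < (lambertW I).im := lambertW_im_pos (by simp)
  have hpi := lambertUpper_im_lt_pi hU
  have h1 := congrArg re hw
  have h2 := congrArg im hw
  rw [mul_exp_re, I_re] at h1
  rw [mul_exp_im, I_im] at h2
  set a := (lambertW I).re
  set b := (lambertW I).im
  have hs := Real.sin_pos_of_pos_of_lt_pi hb hpi
  have hE := Real.exp_pos a
  have h3 : a * Real.cos b - b * Real.sin b = 0 := (mul_eq_zero.1 h1).resolve_left hE.ne'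
  have hsum : 0 < a * Real.sin b + b * Real.cos b := by
    by_contra hcon
    have := mul_nonpos_of_nonneg_of_nonpos hE.le (not_lt.1 hcon)
    linarith
  have h4 := Real.sin_sq_add_cos_sq b
  have hcos : 0 < Real.cos b := by
    have e : (a * Real.sin b + b * Real.cos b) * Real.cos b = b := by
      linear_combination Real.sin b * h3 + b * h4
    by_contra hcon
    have := mul_nonpos_of_nonneg_of_nonpos hsum.le (not_lt.1 hcon)
    linarith
  refine ⟨hb, ?_, ?_, ?_⟩
  · by_contra hcon
    have := Real.cos_nonpos_of_pi_div_two_le_of_le (not_lt.1 hcon) (by linarith)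
    linarith
  · rw [eq_div_iff hcos.ne']; linarith
  · rw [Real.exp_neg, eq_div_iff hcos.ne', inv_mul_eq_div, div_eq_iff hE.ne']
    linear_combination (-Real.cos b) * h2 + Real.exp a * Real.sin b * h3 +
      Real.exp a * b * h4

theorem div_cos_lt_div_cos {x y : ℝ} (h0 : 0 < x) (hxy : x < y) (hy : y < Real.pi / 2) :
    x / Real.cos x < y / Real.cos y ∧
      x * Real.sin x / Real.cos x < y * Real.sin y / Real.cos y := by
  have hcy : 0 < Real.cos y := Real.cos_pos_of_mem_Ioo ⟨by linarith, hy⟩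
  have hc : Real.cos y ≤ Real.cos x :=
    Real.cos_le_cos_of_nonneg_of_le_pi h0.le (by linarith) hxy.le
  have hs : Real.sin x ≤ Real.sin y :=
    Real.sin_le_sin_of_le_of_le_pi_div_two (by linarith) hy.le hxy.le
  have hsx : 0 < Real.sin x := Real.sin_pos_of_pos_of_lt_pi h0 (by linarith)
  have h1 : x / Real.cos x < y / Real.cos y :=
    div_lt_div₀ hxy hc (by linarith) hcy
  refine ⟨h1, ?_⟩
  rw [mul_div_right_comm, mul_div_right_comm y]
  have : 0 < x / Real.cos x := div_pos h0 (hcy.trans_le hc)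
  exact mul_lt_mul h1 hs hsx (this.trans h1).le

theorem cos_sin_lower_bound :
    (0.8384231789 < Real.cos 0.57641272 ∧ Real.cos 0.57641272 < 0.8384231790) ∧
      (0.5450197913 < Real.sin 0.57641272 ∧ Real.sin 0.57641272 < 0.5450197914) := by
  obtain ⟨h1, h2⟩ := abs_cos_sub_taylor_le_and_abs_sin_sub_taylor_le (x := 0.57641272) (by norm_num) (by norm_num)
  rw [abs_le] at h1 h2
  norm_num at h1 h2 ⊢
  refine ⟨⟨?_, ?_⟩, ?_, ?_⟩ <;> linarith

theorem cos_sin_upper_bound :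
    (0.8384231735 < Real.cos 0.57641273 ∧ Real.cos 0.57641273 < 0.8384231736) ∧
      (0.5450197997 < Real.sin 0.57641273 ∧ Real.sin 0.57641273 < 0.5450197998) := by
  obtain ⟨h1, h2⟩ := abs_cos_sub_taylor_le_and_abs_sin_sub_taylor_le (x := 0.57641273) (by norm_num) (by norm_num)
  rw [abs_le] at h1 h2
  norm_num at h1 h2 ⊢
  refine ⟨⟨?_, ?_⟩, ?_, ?_⟩ <;> linarith

theorem exp_upper_bound : Real.exp 0.374699018 ≤ 1.454553555 := by
  refine (Real.exp_bound' (n := 10) (by norm_num) (by norm_num) (by norm_num)).trans ?_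
  simp only [Finset.sum_range_succ, Finset.sum_range_zero, Nat.factorial]
  norm_num

theorem exp_lower_bound : 1.45455357 ≤ Real.exp 0.374699030 := by
  refine le_trans ?_ (Real.sum_le_exp_of_nonneg (by norm_num) 10)
  simp only [Finset.sum_range_succ, Finset.sum_range_zero, Nat.factorial]
  norm_num

/-- The function `e^(b tan b) b / cos b` increases on `(0, π/2)` and equals `1` at `b = Im W(i)`; it
is below `1` at the left endpoint and above `1` at the right one. -/
theorem lambertW_I_im_bounds :
    0.57641272 < (lambertW I).im ∧ (lambertW I).im < 0.57641273 := by
  obtain ⟨hb, hb2, ha, he⟩ := lambertW_I_equations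
  have hpi := Real.pi_gt_three
  obtain ⟨⟨c1, c2⟩, s1, s2⟩ := cos_sin_lower_bound
  obtain ⟨⟨d1, d2⟩, r1, r2⟩ := cos_sin_upper_bound
  have hone : Real.exp (lambertW I).re * ((lambertW I).im / Real.cos (lambertW I).im) = 1 := by
    rw [← he, ← Real.exp_add, add_neg_cancel, Real.exp_zero]
  have hpos : 0 < (lambertW I).im / Real.cos (lambertW I).im := he ▸ Real.exp_pos _
  constructor
  · by_contra hcon
    have hle : (lambertW I).im / Real.cos (lambertW I).im ≤ 0.57641272 / Real.cos 0.57641272 ∧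
        (lambertW I).re ≤ 0.57641272 * Real.sin 0.57641272 / Real.cos 0.57641272 := by
      rw [ha]
      rcases (not_lt.1 hcon).eq_or_lt with h | h
      · rw [h]; exact ⟨le_rfl, le_rfl⟩
      · have := div_cos_lt_div_cos hb h (by linarith)
        exact ⟨this.1.le, this.2.le⟩
    have h1 : (0.57641272 : ℝ) / Real.cos 0.57641272 ≤ 0.687496165 := by
      rw [div_le_iff₀ (by linarith)]; linarith
    have h2 : (0.57641272 : ℝ) * Real.sin 0.57641272 / Real.cos 0.57641272 ≤ 0.374699018 := by
      rw [div_le_iff₀ (by linarith)]; linarith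
    have h3 : Real.exp (lambertW I).re ≤ 1.454553555 :=
      (Real.exp_le_exp.2 (hle.2.trans h2)).trans exp_upper_bound
    have h4 := mul_le_mul h3 (hle.1.trans h1) hpos.le (by norm_num)
    rw [hone] at h4
    norm_num at h4
  · by_contra hcon
    have hle : 0.57641273 / Real.cos 0.57641273 ≤ (lambertW I).im / Real.cos (lambertW I).im ∧
        0.57641273 * Real.sin 0.57641273 / Real.cos 0.57641273 ≤ (lambertW I).re := by
      rw [ha]
      rcases (not_lt.1 hcon).eq_or_lt with h | h
      · rw [← h]; exact ⟨le_rfl, le_rfl⟩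
      · have := div_cos_lt_div_cos (by norm_num) h hb2
        exact ⟨this.1.le, this.2.le⟩
    have h1 : 0.687496181 ≤ (0.57641273 : ℝ) / Real.cos 0.57641273 := by
      rw [le_div_iff₀ (by linarith)]; linarith
    have h2 : 0.374699030 ≤ (0.57641273 : ℝ) * Real.sin 0.57641273 / Real.cos 0.57641273 := by
      rw [le_div_iff₀ (by linarith)]; linarith
    have h3 : 1.45455357 ≤ Real.exp (lambertW I).re :=
      exp_lower_bound.trans (Real.exp_le_exp.2 (h2.trans hle.2))
    have h4 := mul_le_mul h3 (h1.trans hle.1) (by norm_num) (Real.exp_pos _).le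
    rw [hone] at h4
    norm_num at h4

theorem I_div_lambertW_I_re :
    (I / lambertW I).re = Real.cos (lambertW I).im ^ 2 / (lambertW I).im := by
  obtain ⟨hb, hb2, ha, he⟩ := lambertW_I_equations
  have hc : 0 < Real.cos (lambertW I).im := Real.cos_pos_of_mem_Ioo ⟨by linarith, hb2⟩
  rw [self_div_lambertW I_ne_zero, exp_re, ← neg_neg (lambertW I).re, Real.exp_neg, he]
  field_simp

theorem div_I_re (w : ℂ) : (w / I).re = w.im := by simp

theorem lambertW_I_numerics :
    (lambertW I).re ∈ Ico (0.3746990 : ℝ) 0.3746991 ∧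
    Real.exp (-(lambertW I).re) ∈ Ico (0.6874961 : ℝ) 0.6874962 ∧
    (lambertW I).im ∈ Ico (0.5764127 : ℝ) 0.5764128 ∧
    (I / lambertW I).re ∈ Ico (1.21953 : ℝ) 1.21954 := by
  obtain ⟨hb, hb2, ha, he⟩ := lambertW_I_equations
  obtain ⟨hl, hu⟩ := lambertW_I_im_bounds
  have hpi := Real.pi_gt_three
  obtain ⟨⟨c1, c2⟩, s1, s2⟩ := cos_sin_lower_bound
  obtain ⟨⟨d1, d2⟩, r1, r2⟩ := cos_sin_upper_bound
  obtain ⟨m1, m2⟩ := div_cos_lt_div_cos (by norm_num) hl hb2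
  obtain ⟨n1, n2⟩ := div_cos_lt_div_cos hb hu (by linarith)
  have k1 := Real.cos_le_cos_of_nonneg_of_le_pi (by norm_num) (by linarith) hl.le
  have k2 := Real.cos_le_cos_of_nonneg_of_le_pi hb.le (by linarith) hu.le
  refine ⟨⟨?_, ?_⟩, ⟨?_, ?_⟩, ⟨by linarith, by linarith⟩, ?_, ?_⟩
  · rw [ha]
    refine le_trans ?_ m2.le
    rw [le_div_iff₀ (by linarith)]; linarith
  · rw [ha]
    refine n2.trans_le ?_
    rw [div_le_iff₀ (by linarith)]; linarith
  · rw [he]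
    refine le_trans ?_ m1.le
    rw [le_div_iff₀ (by linarith)]; linarith
  · rw [he]
    refine n1.trans_le ?_
    rw [div_le_iff₀ (by linarith)]; linarith
  · rw [I_div_lambertW_I_re, le_div_iff₀ hb]
    nlinarith
  · rw [I_div_lambertW_I_re, div_lt_iff₀ hb]
    nlinarith

end

theorem mainTheorem11 :
    -- the representations of `W`, `W / z` and `z / W` on the cut plane `|arg z| < π`
    (∀ z : ℂ, z ≠ 0 → |Complex.arg z| < Real.pi →
      (IntervalIntegrable (fun v : ℝ => lambertK z v * (lambertT v : ℂ)) volume 0 Real.pi ∧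
        lambertW z = (((lambertW Complex.I).re : ℝ) : ℂ) +
          1 / (Real.pi : ℂ) * ∫ v in (0 : ℝ)..Real.pi, lambertK z v * (lambertT v : ℂ)) ∧
      lambertW z / z = ((Real.exp (-(lambertW Complex.I).re) : ℝ) : ℂ) *
          Complex.exp (-(1 / (Real.pi : ℂ) *
            ∫ v in (0 : ℝ)..Real.pi, lambertK z v * (lambertT v : ℂ))) ∧
      (IntervalIntegrable (fun v : ℝ => lambertK z v) volume 0 Real.pi ∧
        lambertW z / z = (((lambertW Complex.I / Complex.I).re : ℝ) : ℂ) +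
          1 / (Real.pi : ℂ) * ∫ v in (0 : ℝ)..Real.pi, lambertK z v) ∧
      (IntervalIntegrable
          (fun v : ℝ => lambertK z v * ((Real.exp (-2 * v * Real.cot v) : ℝ) : ℂ))
          volume 0 Real.pi ∧
        z / lambertW z = (((Complex.I / lambertW Complex.I).re : ℝ) : ℂ) -
          1 / (Real.pi : ℂ) * ∫ v in (0 : ℝ)..Real.pi,
            lambertK z v * ((Real.exp (-2 * v * Real.cot v) : ℝ) : ℂ))) ∧
    -- the first one is the Nevanlinna representation of the Pick function `W`
    (IsPickFunction lambertW ∧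
      HasPickRepresentation lambertW (lambertW Complex.I).re 0 lambertPickMeasure) ∧
    -- the constants, with decimals truncated
    (lambertW Complex.I / Complex.I).re = (lambertW Complex.I).im ∧
    (lambertW Complex.I).re ∈ Set.Ico (0.3746990 : ℝ) 0.3746991 ∧
    Real.exp (-(lambertW Complex.I).re) ∈ Set.Ico (0.6874961 : ℝ) 0.6874962 ∧
    (lambertW Complex.I).im ∈ Set.Ico (0.5764127 : ℝ) 0.5764128 ∧
    (Complex.I / lambertW Complex.I).re ∈ Set.Ico (1.21953 : ℝ) 1.21954 := by
  refine ⟨fun z hz0 harg => ?_, ⟨isPickFunction_lambertW, hasPickRepresentation_lambertW⟩,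
    div_I_re _, lambertW_I_numerics⟩
  have hz : z ∈ slitPlane := mem_slitPlane_iff_arg.2
    ⟨fun h => by rw [h, abs_of_pos Real.pi_pos] at harg; exact lt_irrefl _ harg, hz0⟩
  have h1 := lambertW_representation hz
  have h2 := exp_neg_lambertW_representation hz
  have h3 := exp_lambertW_representation hz
  rw [lambertW_div_self hz0, lambertW_div_self I_ne_zero, self_div_lambertW hz0,
    self_div_lambertW I_ne_zero]
  refine ⟨h1, ?_, h2, h3⟩
  -- The product formula is `W/z = e^(-W)` with the first representation inserted in the exponent.
  rw [ofReal_exp, ← Complex.exp_add, h1.2]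
  congr 1
  push_cast
  ring
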